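/- Consider the continuous-time Poisson channel with noiseless feedback, dark current $\lambda_0\ge 0$ and no peak-power constraint. A coding/decoding rule for $M\ge 1$ equiprobable messages $m\in\{1,\dots,M\}$ consists of a transmission interval $[0,T]$, $T>0$, and of the following. (i) For each message $m$ there is a probability law $P_m$ (the conditional law given that $m$ is sent), a history (filtration) $(\mathcal F^m_t)_{t\ge 0}$ and a nonnegative $\mathcal F^m_t$-progressive input process $X_m$ such that, under $P_m$, the output counting process $Y$ admits the $\mathcal F^m_t$-intensity $X_m(t)+\lambda_0$; that is, $Y$ is $\mathcal F^m_t$-adapted, $\int_0^t X_m(s)\,ds<\infty$ almost surely for all $t\ge 0$, and for every nonnegative $\mathcal F^m_t$-predictable process $C$ $$\mathbb E_m\Big[\int_0^\infty C(t)\,dY(t)\Big]=\mathbb E_m\Big[\int_0^\infty C(t)\,\big(X_m(t)+\lambda_0\big)\,dt\Big].$$ (ii) A decoder: a guess of the message that is measurable with respect to the $\sigma$-algebra generated by $\{Y(t):0\le t\le T\}$. Its average transmitted energy, in photons, is $\frac1M\sum_{m=1}^{M}\mathbb E_m\big[\int_0^T X_m(t)\,dt\big]$, and its probability of error is $\frac1M\sum_{m=1}^{M}P_m(\text{the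 guess is not } m)$. One of $M$ equiprobable messages (that is, $\log_2 M$ bits) can be transmitted reliably with average transmitted energy $\mathcal E$ if for every $\varepsilon>0$ there is a coding/decoding rule, for some $T$, of average transmitted energy $\mathcal E$ and probability of error smaller than $\varepsilon$. Then, for every $M\ge 1$ and every dark current $\lambda_0\ge 0$, the least energy with which one of $M$ equiprobable messages can be transmitted reliably exists and equals $$\frac{M-1}{M}.$$ -/

import Mathlib

open MeasureTheory
open scoped NNReal ENNReal

universe u

/-- Lebesgue measure on the time axis `[0, ∞)`. -/
noncomputable def timeMeasure : Measure ℝ≥0 :=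
  Measure.comap ((↑) : ℝ≥0 → ℝ) volume

/-- `y : [0, ∞) → ℕ` is the path of a simple counting process: it starts at `0`, is nondecreasing
and right-continuous, and its jumps have size one. -/
structure IsCountingPath (y : ℝ≥0 → ℕ) : Prop where
  zero : y 0 = 0
  mono : Monotone y
  rightCont : ∀ t, ContinuousWithinAt y (Set.Ici t) t
  unitJump : ∀ t, 0 < t → ∃ s < t, y t ≤ y s + 1

/-- The times at which counts are registered by a counting path, i.e. the `t > 0` such that
`y (t-) < y t`. -/
def countTimes (y : ℝ≥0 → ℕ) : Set ℝ≥0 :=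
  {t | 0 < t ∧ ∀ s < t, y s < y t}

/-- The pathwise integral `∫_0^∞ c(t) dy(t)` of a nonnegative function against a simple counting
path: the sum of the values of `c` at the count times. -/
noncomputable def countIntegral (c : ℝ≥0 → ℝ≥0∞) (y : ℝ≥0 → ℕ) : ℝ≥0∞ :=
  ∑' t : countTimes y, c t

/-- Under the law `P`, the counting process `Y` admits the `F`-intensity `rate`: `Y` is a point
process adapted to the history `F`, `rate` is a nonnegative `F`-progressive process which is
almost surely integrable on bounded intervals, and
`E[∫_0^∞ C(t) dY(t)] = E[∫_0^∞ C(t) rate(t) dt]` for every nonnegative `F`-predictable `C`. -/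
structure AdmitsIntensity {Ω : Type*} {mΩ : MeasurableSpace Ω} (P : Measure Ω)
    (F : Filtration ℝ≥0 mΩ) (Y : ℝ≥0 → Ω → ℕ) (rate : ℝ≥0 → Ω → ℝ≥0) : Prop where
  countingPath : ∀ ω, IsCountingPath fun t => Y t ω
  adapted : Adapted F Y
  progressive : IsProgressive F rate
  locallyIntegrable : ∀ t : ℝ≥0, ∀ᵐ ω ∂P, ∫⁻ s in Set.Iic t, (rate s ω : ℝ≥0∞) ∂timeMeasure < ∞
  intensity : ∀ C : ℝ≥0 → Ω → ℝ≥0∞,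
    Measurable[F.predictable] (fun p : ℝ≥0 × Ω => C p.1 p.2) →
      ∫⁻ ω, countIntegral (fun t => C t ω) (fun t => Y t ω) ∂P
        = ∫⁻ ω, (∫⁻ t, C t ω * (rate t ω : ℝ≥0∞) ∂timeMeasure) ∂P

/-- A coding/decoding rule with transmission interval `[0, T]` for one of `M` messages over the
Poisson channel with feedback and dark current `dark`. No peak-power constraint is imposed.

* `P m` is the conditional law, given that the message is `m`, on a sample space `Ω`;
* `Y` is the channel output, i.e. the counting process seen by the receiver;
* `F m` is the history, given message `m`, to which `Y` is adapted and on which the channel input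
  `X m` may causally depend;
* given message `m`, the output admits the `F m`-intensity `X m + dark`;
* `decode` guesses the message from the output on `[0, T]`, and it is measurable for the σ-algebra
  generated by the values of the output at the times in `[0, T]`. -/
structure FeedbackScheme (M : ℕ) (dark : ℝ≥0) where
  T : ℝ≥0
  T_pos : 0 < T
  Ω : Type u
  mΩ : MeasurableSpace Ω
  P : Fin M → Measure Ω
  prob : ∀ m, IsProbabilityMeasure (P m)
  F : Fin M → Filtration ℝ≥0 mΩ
  Y : ℝ≥0 → Ω → ℕ
  X : Fin M → ℝ≥0 → Ω → ℝ≥0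
  input_progressive : ∀ m, IsProgressive (F m) (X m)
  channel : ∀ m, AdmitsIntensity (P m) (F m) Y (fun t ω => X m t ω + dark)
  decode : (Set.Iic T → ℕ) → Fin M
  decode_measurable : Measurable decode

namespace FeedbackScheme

variable {M : ℕ} {dark : ℝ≥0}

/-- The conditional expected transmitted energy (in photons) over `[0, T]` given message `m`. -/
noncomputable def messageEnergy (S : FeedbackScheme M dark) (m : Fin M) : ℝ≥0∞ :=
  letI := S.mΩ
  ∫⁻ ω, (∫⁻ t in Set.Iic S.T, (S.X m t ω : ℝ≥0∞) ∂timeMeasure) ∂(S.P m)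

/-- The average transmitted energy when the messages are equiprobable. -/
noncomputable def energy (S : FeedbackScheme M dark) : ℝ≥0∞ :=
  (∑ m, S.messageEnergy m) / M

/-- The conditional probability of a decoding error given message `m`. -/
noncomputable def messageError (S : FeedbackScheme M dark) (m : Fin M) : ℝ≥0∞ :=
  letI := S.mΩ
  S.P m {ω | S.decode (fun t => S.Y t ω) ≠ m}

/-- The probability of a decoding error when the messages are equiprobable. -/
noncomputable def errorProb (S : FeedbackScheme M dark) : ℝ≥0∞ :=
  (∑ m, S.messageError m) / M

end FeedbackScheme

/-- One of `M` equiprobable messages can be transmitted reliably with average transmitted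
energy `E`: for every `ε > 0` there is a coding/decoding rule, for some transmission interval, of
expected transmitted energy `E` and probability of error smaller than `ε`. -/
def ReliablyTransmittable (M : ℕ) (dark : ℝ≥0) (E : ℝ≥0∞) : Prop :=
  ∀ ε : ℝ≥0∞, 0 < ε →
    ∃ S : FeedbackScheme.{u} M dark, S.energy = E ∧ S.errorProb < ε

/-!
The converse. The output given a message is compared with a process that does not depend on the
message. If `Y` has the intensity `X + dark`, then over a short interval `(a, b]` and for a function
`φ` with values in `[0, 1]`, telescoping `φ (Y b) - φ (Y a)` along the jumps and taking expectations
through the defining identity of the intensity shows that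
`E φ (Y b) ≤ E [(1 - p) φ (Y a) + p φ (Y a + 1)] + E ∫_a^b X` with `p = dark * (b - a)`, up to an
error of second order (`AdmitsIntensity.lintegral_step_le`). Along a grid on `[0, T]` this compares
the sampled output with a Bernoulli walk: the law of the output exceeds that of the walk by at most
the energy spent, on every event (`AdmitsIntensity.lintegral_gridHistory_le_walkExp`). The walk being
the same for all the messages, its probabilities of the `M` disjoint decision regions sum up to at
most `1`, so the probabilities of correct decoding sum up to at most `1` plus the sum of the
energies. The decision regions are arbitrary events of the path on `[0, T]`; they are approximated by
events of the sampled path (`eventually_exists_gridHistory_approx`) while the mesh tends to zero.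
The result is `M ≤ 1 + ∑ energy + ∑ error`
(`FeedbackScheme.card_le_one_add_sum_messageEnergy`).

Achievability. Message `m` is sent as a single photon, uniformly distributed on a slot of length
`δ`. The feedback lets the input `X m` be the hazard rate `1 / (b - t)` of the uniform law up to the
arrival of the photon and `0` afterwards, so that exactly one photon is spent on average. The slot
of the last message begins when the transmission ends; this message costs nothing, and the average
energy is exactly `(M - 1) / M`. An error needs a dark count before the time `M δ`, which is
unlikely for small `δ`.

The output is built from independent variables: the time of the signal photon and the exponential
gaps between the dark counts. A random time `R + τ`, where `τ` is independent of the other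
variables and has the hazard rate `h`, satisfies the identity that defines an intensity for all
integrands that do not depend on `τ` (`lintegral_hazard`, by Tonelli's theorem). The history
`jumpFiltration` is the largest one in which nothing about the variable triggering a count is known
before that count, and for which a predictable process is therefore such an integrand up to the count
(`exists_eq_of_predictable`). Adding up the counts gives the intensity of the superposition
(`admitsIntensity_jumpCount`, `admitsIntensity_pulse`).
-/

/-! ### Lebesgue measure on the half-line -/

lemma measurableEmbedding_nnreal_coe : MeasurableEmbedding ((↑) : ℝ≥0 → ℝ) :=
  MeasurableEmbedding.subtype_coe measurableSet_Ici

lemma map_coe_timeMeasure :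
    timeMeasure.map ((↑) : ℝ≥0 → ℝ) = volume.restrict (Set.Ici 0) := by
  rw [timeMeasure, measurableEmbedding_nnreal_coe.map_comap]
  congr 1
  exact Subtype.range_coe

lemma lintegral_timeMeasure (f : ℝ → ℝ≥0∞) :
    ∫⁻ t, f (t : ℝ≥0) ∂timeMeasure = ∫⁻ x in Set.Ici 0, f x := by
  rw [← map_coe_timeMeasure, measurableEmbedding_nnreal_coe.lintegral_map]

lemma timeMeasure_preimage_coe (s : Set ℝ) :
    timeMeasure (((↑) : ℝ≥0 → ℝ) ⁻¹' s) = volume (s ∩ Set.Ici 0) := by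
  rw [timeMeasure, measurableEmbedding_nnreal_coe.comap_apply, Set.image_preimage_eq_inter_range]
  congr 2
  exact Subtype.range_coe

lemma timeMeasure_Ioc (a b : ℝ≥0) : timeMeasure (Set.Ioc a b) = ((b - a : ℝ≥0) : ℝ≥0∞) := by
  have h : Set.Ioc a b = ((↑) : ℝ≥0 → ℝ) ⁻¹' Set.Ioc (a : ℝ) b := by ext; simp
  rw [h, timeMeasure_preimage_coe, Set.inter_eq_left.2, Real.volume_Ioc]
  · rw [ENNReal.ofReal, ← NNReal.sub_def]
  · exact fun x hx => a.2.trans hx.1.le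

lemma timeMeasure_Ico (a b : ℝ≥0) : timeMeasure (Set.Ico a b) = ((b - a : ℝ≥0) : ℝ≥0∞) := by
  have h : Set.Ico a b = ((↑) : ℝ≥0 → ℝ) ⁻¹' Set.Ico (a : ℝ) b := by ext; simp
  rw [h, timeMeasure_preimage_coe, Set.inter_eq_left.2, Real.volume_Ico]
  · rw [ENNReal.ofReal, ← NNReal.sub_def]
  · exact fun x hx => a.2.trans hx.1

lemma timeMeasure_Iic (b : ℝ≥0) : timeMeasure (Set.Iic b) = b := by
  have h : Set.Iic b = ((↑) : ℝ≥0 → ℝ) ⁻¹' Set.Iic (b : ℝ) := by ext; simp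
  rw [h, timeMeasure_preimage_coe, Set.inter_comm, Set.Ici_inter_Iic, Real.volume_Icc, sub_zero,
    ENNReal.ofReal_coe_nnreal]

lemma timeMeasure_singleton (a : ℝ≥0) : timeMeasure {a} = 0 := by
  have h : ({a} : Set ℝ≥0) = ((↑) : ℝ≥0 → ℝ) ⁻¹' {(a : ℝ)} := by ext; simp
  rw [h, timeMeasure_preimage_coe]
  exact measure_mono_null Set.inter_subset_left (by simp)

instance instNullSingletonTimeMeasure : NullSingletonClass timeMeasure := ⟨timeMeasure_singleton⟩

instance instSigmaFiniteTimeMeasure : SigmaFinite timeMeasure := by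
  have := measurableEmbedding_nnreal_coe
  have h : SigmaFinite (timeMeasure.map ((↑) : ℝ≥0 → ℝ)) := by
    rw [map_coe_timeMeasure]; infer_instance
  exact SigmaFinite.of_map _ this.measurable.aemeasurable h

/-! ### Counting paths -/

/-- The left limit `y (t-)` of a counting path, with the convention `y (0-) = 0`. -/
noncomputable def leftVal (y : ℝ≥0 → ℕ) (t : ℝ≥0) : ℕ := ⨆ s : Set.Iio t, y s

lemma lt_leftVal_iff {y : ℝ≥0 → ℕ} (hy : Monotone y) {t : ℝ≥0} {j : ℕ} :
    j < leftVal y t ↔ ∃ s < t, j < y s := by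
  have hb : BddAbove (Set.range fun s : Set.Iio t => y s) :=
    ⟨y t, by rintro _ ⟨s, rfl⟩; exact hy (le_of_lt s.2)⟩
  constructor
  · intro h
    by_contra! hc
    refine absurd h (not_lt.2 ?_)
    rcases isEmpty_or_nonempty (Set.Iio t) with he | he
    · simp [leftVal]
    · exact ciSup_le fun s => hc s s.2
  · rintro ⟨s, hs, hj⟩
    exact hj.trans_le (le_ciSup hb ⟨s, hs⟩)

lemma leftVal_le {y : ℝ≥0 → ℕ} (hy : Monotone y) (t : ℝ≥0) : leftVal y t ≤ y t := by
  by_contra! h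
  obtain ⟨s, hs, h⟩ := (lt_leftVal_iff hy).1 h
  exact absurd (hy hs.le) (not_le.2 h)

lemma le_leftVal {y : ℝ≥0 → ℕ} (hy : Monotone y) {s t : ℝ≥0} (hst : s < t) :
    y s ≤ leftVal y t := by
  by_contra! h
  exact lt_irrefl _ ((lt_leftVal_iff hy).2 ⟨s, hst, h⟩)

lemma injOn_countTimes (y : ℝ≥0 → ℕ) : Set.InjOn y (countTimes y) := by
  intro s hs t ht h
  rcases lt_trichotomy s t with hst | hst | hst
  · exact absurd h (ht.2 s hst).ne
  · exact hst
  · exact absurd h (hs.2 t hst).ne'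

namespace IsCountingPath

variable {y : ℝ≥0 → ℕ}

lemma eq_leftVal_add_one (hy : IsCountingPath y) {t : ℝ≥0} (ht : t ∈ countTimes y) :
    y t = leftVal y t + 1 := by
  obtain ⟨s, hs, h⟩ := hy.unitJump t ht.1
  have h1 := le_leftVal hy.mono hs
  have h2 : leftVal y t < y t := by
    by_contra! hc
    have h3 : 0 < y t := (Nat.zero_le _).trans_lt (ht.2 s hs)
    obtain ⟨r, hr, h4⟩ := (lt_leftVal_iff hy.mono (t := t) (j := y t - 1)).1 (by omega)
    have := ht.2 r hr
    omega
  omega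

/-- A counting path passes through every level at a count time. -/
lemma exists_countTime (hy : IsCountingPath y) {a b : ℝ≥0} {j : ℕ} (ha : y a < j) (hb : j ≤ y b) :
    ∃ t ∈ countTimes y, t ∈ Set.Ioc a b ∧ y t = j := by
  set S : Set ℝ≥0 := {t | j ≤ y t} with hS
  have hne : S.Nonempty := ⟨b, hb⟩
  have hbdd : BddBelow S := OrderBot.bddBelow S
  set t := sInf S with ht
  have hlt : ∀ s < t, y s < j := fun s hs => not_le.1 fun h => notMem_of_lt_csInf hs hbdd h
  -- right-continuity: the infimum defining the passage time is attained
  have hge : j ≤ y t := by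
    by_contra! hc
    have hev : ∀ᶠ s in nhdsWithin t (Set.Ici t), y s = y t :=
      (hy.rightCont t).eventually (p := fun n => n = y t) (by simp)
    obtain ⟨u, hu, hsub⟩ := mem_nhdsGE_iff_exists_Ico_subset.1 hev
    obtain ⟨s, hsS, hsu⟩ := exists_lt_of_csInf_lt hne hu
    have : y s = y t := hsub ⟨csInf_le hbdd hsS, hsu⟩
    have h2 : j ≤ y s := hsS
    omega
  have hat : a < t := by
    by_contra! hc
    have := hy.mono hc
    omega
  have ht0 : 0 < t := zero_le.trans_lt hat
  obtain ⟨s, hs, hs1⟩ := hy.unitJump t ht0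
  have heq : y t = j := by have := hlt s hs; omega
  exact ⟨t, ⟨ht0, fun s hs => heq ▸ hlt s hs⟩, ⟨hat, csInf_le hbdd hb⟩, heq⟩

lemma countIntegral_Ioc (hy : IsCountingPath y) {a b : ℝ≥0} (g : ℕ → ℝ≥0∞) :
    countIntegral ((Set.Ioc a b).indicator fun t => g (y t)) y
      = ∑ j ∈ Finset.Ioc (y a) (y b), g j := by
  have himg : y '' (countTimes y ∩ Set.Ioc a b) = Finset.Ioc (y a) (y b) := by
    ext j
    simp only [Set.mem_image, Finset.coe_Ioc]
    constructor
    · rintro ⟨t, ⟨ht, hab⟩, rfl⟩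
      exact ⟨ht.2 a hab.1, hy.mono hab.2⟩
    · rintro ⟨h1, h2⟩
      obtain ⟨t, ht, hab, h⟩ := hy.exists_countTime h1 h2
      exact ⟨t, ⟨ht, hab⟩, h⟩
  have h1 : countIntegral ((Set.Ioc a b).indicator fun t => g (y t)) y
      = ∑' t : ↑(countTimes y ∩ Set.Ioc a b), g (y t) := by
    rw [countIntegral, tsum_subtype (countTimes y) ((Set.Ioc a b).indicator fun t => g (y t)),
      Set.indicator_indicator, ← tsum_subtype]
  rw [h1, ← tsum_image g ((injOn_countTimes y).mono Set.inter_subset_left), himg]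
  exact Finset.tsum_subtype' _ g

/-- Telescoping along the jumps: `φ (y b) - φ (y a)` is the sum of the increments of `φ` at the
count times in `(a, b]`, written without subtraction. -/
lemma countIntegral_telescope (hy : IsCountingPath y) {a b : ℝ≥0} (hab : a ≤ b) (φ : ℕ → ℝ≥0∞) :
    φ (y b) + countIntegral ((Set.Ioc a b).indicator fun t => φ (leftVal y t)) y
      = φ (y a) + countIntegral ((Set.Ioc a b).indicator fun t => φ (leftVal y t + 1)) y := by
  have h1 : countIntegral ((Set.Ioc a b).indicator fun t => φ (leftVal y t)) y
      = countIntegral ((Set.Ioc a b).indicator fun t => φ (y t - 1)) y := by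
    refine tsum_congr fun t => ?_
    simp only [Set.indicator]
    rw [hy.eq_leftVal_add_one t.2, Nat.add_sub_cancel]
  have h2 : countIntegral ((Set.Ioc a b).indicator fun t => φ (leftVal y t + 1)) y
      = countIntegral ((Set.Ioc a b).indicator fun t => φ (y t)) y := by
    refine tsum_congr fun t => ?_
    simp only [Set.indicator]
    rw [hy.eq_leftVal_add_one t.2]
  rw [h1, h2, hy.countIntegral_Ioc (fun j => φ (j - 1)), hy.countIntegral_Ioc φ]
  have hle := hy.mono hab
  generalize y a = p at *
  generalize y b = q at *
  induction q, hle using Nat.le_induction with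
  | base => simp
  | succ q hq ih =>
    rw [← Finset.insert_Ioc_right_eq_Ioc_add_one hq, Finset.sum_insert (by simp),
      Finset.sum_insert (by simp), Nat.add_sub_cancel, ih]
    ring

lemma countIntegral_one (hy : IsCountingPath y) {a b : ℝ≥0} :
    countIntegral ((Set.Ioc a b).indicator fun _ => 1) y = ((y b - y a : ℕ) : ℝ≥0∞) := by
  rw [hy.countIntegral_Ioc (fun _ => 1)]
  simp

end IsCountingPath

/-! ### The one-step estimate for a process with intensity `X + dark` -/

section OneStep

variable {Ω : Type*} {mΩ : MeasurableSpace Ω} {F : Filtration ℝ≥0 mΩ} {Y : ℝ≥0 → Ω → ℕ}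

lemma predictable_le_prod (F : Filtration ℝ≥0 mΩ) :
    F.predictable ≤ (inferInstance : MeasurableSpace (ℝ≥0 × Ω)) :=
  measurableSpace_le_predictable_of_measurableSet
    (fun _ hA => (measurableSet_singleton _).prod (F.le _ _ hA))
    (fun _ _ hA => measurableSet_Ioi.prod (F.le _ _ hA))

lemma measurable_leftVal_predictable (hY : Adapted F Y) (hmono : ∀ ω, Monotone fun t => Y t ω) :
    Measurable[F.predictable] fun p : ℝ≥0 × Ω => leftVal (fun t => Y t p.2) p.1 := by
  refine measurable_of_Ioi (mδ := F.predictable) fun j => ?_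
  have : (fun p : ℝ≥0 × Ω => leftVal (fun t => Y t p.2) p.1) ⁻¹' Set.Ioi j
      = ⋃ q : ℚ, Set.Ioi (Real.toNNReal q) ×ˢ (Y (Real.toNNReal q) ⁻¹' Set.Ioi j) := by
    ext ⟨t, ω⟩
    simp only [Set.mem_preimage, Set.mem_Ioi, lt_leftVal_iff (hmono ω), Set.mem_iUnion,
      Set.mem_prod]
    constructor
    · rintro ⟨s, hst, hj⟩
      obtain ⟨q, hq1, hq2⟩ := exists_rat_btwn (show (s : ℝ) < t from hst)
      have hq0 : (0 : ℝ) ≤ q := s.2.trans hq1.le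
      refine ⟨q, (Real.toNNReal_lt_iff_lt_coe hq0).2 hq2, hj.trans_le (hmono ω ?_)⟩
      exact (NNReal.le_toNNReal_of_coe_le hq1.le)
    · rintro ⟨q, h1, h2⟩
      exact ⟨_, h1, h2⟩
  rw [this]
  exact MeasurableSet.iUnion fun q =>
    measurableSet_predictable_Ioi_prod (hY _ measurableSet_Ioi)

lemma measurable_indicator_predictable {a b : ℝ≥0} {φ : Ω → ℝ≥0∞} (hφ : Measurable[F a] φ) :
    Measurable[F.predictable] fun p : ℝ≥0 × Ω => (Set.Ioc a b).indicator (fun _ => φ p.2) p.1 := by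
  have h : (fun p : ℝ≥0 × Ω => (Set.Ioc a b).indicator (fun _ => φ p.2) p.1)
      = (Set.Ioc a b ×ˢ Set.univ).indicator fun p : ℝ≥0 × Ω => φ p.2 := by
    ext p
    simp [Set.indicator]
  rw [h]
  intro S hS
  have hI : MeasurableSet[F.predictable] (Set.Ioc a b ×ˢ (Set.univ : Set Ω)) :=
    measurableSet_predictable_Ioc_prod a b MeasurableSet.univ
  have hIS : MeasurableSet[F.predictable] (Set.Ioc a b ×ˢ (φ ⁻¹' S)) :=
    measurableSet_predictable_Ioc_prod a b (hφ hS)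
  have h2 : (Set.Ioc a b ×ˢ (Set.univ : Set Ω)).indicator (fun p : ℝ≥0 × Ω => φ p.2) ⁻¹' S
      = (Set.Ioc a b ×ˢ (φ ⁻¹' S)) ∪
        ((Set.Ioc a b ×ˢ (Set.univ : Set Ω))ᶜ ∩ {_p | (0 : ℝ≥0∞) ∈ S}) := by
    ext p
    by_cases hp : p.1 ∈ Set.Ioc a b <;> simp [Set.indicator, hp]
  rw [h2]
  exact hIS.union (hI.compl.inter (MeasurableSet.const _))

lemma measurable_predictable_leftVal_comp (hY : Adapted F Y)
    (hmono : ∀ ω, Monotone fun t => Y t ω) {a b : ℝ≥0} {φ : Ω → ℕ → ℝ≥0∞}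
    (hφ : ∀ j, Measurable[F a] fun ω => φ ω j) :
    Measurable[F.predictable] fun p : ℝ≥0 × Ω =>
      (Set.Ioc a b).indicator (fun t => φ p.2 (leftVal (fun t => Y t p.2) t)) p.1 := by
  intro S hS
  have h : (fun p : ℝ≥0 × Ω =>
      (Set.Ioc a b).indicator (fun t => φ p.2 (leftVal (fun t => Y t p.2) t)) p.1) ⁻¹' S
      = ⋃ j : ℕ, ((fun p : ℝ≥0 × Ω => leftVal (fun t => Y t p.2) p.1) ⁻¹' {j}) ∩
        ((fun p : ℝ≥0 × Ω => (Set.Ioc a b).indicator (fun _ => φ p.2 j) p.1) ⁻¹' S) := by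
    ext p
    simp [Set.indicator]
  rw [h]
  exact MeasurableSet.iUnion fun j =>
    ((measurable_leftVal_predictable hY hmono) (measurableSet_singleton j)).inter
      (measurable_indicator_predictable (hφ j) hS)

namespace AdmitsIntensity

variable {P : Measure Ω} {X : ℝ≥0 → Ω → ℝ≥0} {dark : ℝ≥0}

lemma measurable_apply {rate : ℝ≥0 → Ω → ℝ≥0} (h : AdmitsIntensity P F Y rate) (t : ℝ≥0) :
    Measurable (Y t) :=
  (h.adapted t).mono (F.le t) le_rfl

lemma intensity_Ioc {rate : ℝ≥0 → Ω → ℝ≥0} (h : AdmitsIntensity P F Y rate) {a b : ℝ≥0}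
    {φ : Ω → ℕ → ℝ≥0∞} (hφ : ∀ j, Measurable[F a] fun ω => φ ω j) :
    ∫⁻ ω, countIntegral ((Set.Ioc a b).indicator fun t => φ ω (leftVal (fun t => Y t ω) t))
        (fun t => Y t ω) ∂P
      = ∫⁻ ω, ∫⁻ t in Set.Ioc a b,
          φ ω (leftVal (fun t => Y t ω) t) * (rate t ω : ℝ≥0∞) ∂timeMeasure ∂P := by
  refine (h.intensity _ (measurable_predictable_leftVal_comp h.adapted
    (fun ω => (h.countingPath ω).mono) hφ)).trans ?_
  refine lintegral_congr fun ω => ?_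
  rw [← lintegral_indicator measurableSet_Ioc]
  refine lintegral_congr fun t => ?_
  by_cases ht : t ∈ Set.Ioc a b <;> simp [ht]

lemma measurable_comp_apply {rate : ℝ≥0 → Ω → ℝ≥0} (h : AdmitsIntensity P F Y rate)
    {φ : Ω → ℕ → ℝ≥0∞} (hφ : ∀ j, Measurable fun ω => φ ω j) (t : ℝ≥0) :
    Measurable fun ω => φ ω (Y t ω) := by
  have h1 : Measurable fun p : ℕ × Ω => φ p.2 p.1 :=
    measurable_from_prod_countable_right fun j => hφ j
  exact h1.comp ((h.measurable_apply t).prodMk measurable_id)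

/-- The telescoping of `φ (Y b) - φ (Y a)` along the jumps, in expectation: the intensity replaces
the counting measure. -/
lemma lintegral_telescope {rate : ℝ≥0 → Ω → ℝ≥0} (h : AdmitsIntensity P F Y rate) {a b : ℝ≥0}
    (hab : a ≤ b) {φ : Ω → ℕ → ℝ≥0∞} (hφ : ∀ j, Measurable[F a] fun ω => φ ω j) :
    ∫⁻ ω, φ ω (Y b ω) ∂P + ∫⁻ ω, ∫⁻ t in Set.Ioc a b,
        φ ω (leftVal (fun t => Y t ω) t) * (rate t ω : ℝ≥0∞) ∂timeMeasure ∂P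
      = ∫⁻ ω, φ ω (Y a ω) ∂P + ∫⁻ ω, ∫⁻ t in Set.Ioc a b,
        φ ω (leftVal (fun t => Y t ω) t + 1) * (rate t ω : ℝ≥0∞) ∂timeMeasure ∂P := by
  have hφ' : ∀ j, Measurable fun ω => φ ω j := fun j => (hφ j).mono (F.le a) le_rfl
  rw [← h.intensity_Ioc hφ, ← h.intensity_Ioc (φ := fun ω j => φ ω (j + 1)) fun j => hφ (j + 1),
    ← lintegral_add_left (h.measurable_comp_apply hφ' b),
    ← lintegral_add_left (h.measurable_comp_apply hφ' a)]
  exact lintegral_congr fun ω => (h.countingPath ω).countIntegral_telescope hab (φ ω)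

lemma lintegral_increment [IsProbabilityMeasure P]
    (h : AdmitsIntensity P F Y (fun t ω => X t ω + dark)) (a b : ℝ≥0) :
    ∫⁻ ω, ((Y b ω - Y a ω : ℕ) : ℝ≥0∞) ∂P
      = ∫⁻ ω, ∫⁻ t in Set.Ioc a b, (X t ω : ℝ≥0∞) ∂timeMeasure ∂P + dark * (b - a : ℝ≥0) := by
  have h1 := h.intensity_Ioc (a := a) (b := b) (φ := fun _ _ => 1) fun _ => measurable_const
  simp only [one_mul, ENNReal.coe_add] at h1
  rw [lintegral_congr fun ω => ((h.countingPath ω).countIntegral_one (a := a) (b := b))] at h1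
  rw [h1, lintegral_congr fun ω => lintegral_add_right _ measurable_const,
    lintegral_add_right _ measurable_const]
  simp [timeMeasure_Ioc]

lemma measure_ne_le [IsProbabilityMeasure P]
    (h : AdmitsIntensity P F Y (fun t ω => X t ω + dark)) {a b : ℝ≥0} (hab : a ≤ b) :
    P {ω | Y b ω ≠ Y a ω} ≤ ∫⁻ ω, ∫⁻ t in Set.Ioc a b, (X t ω : ℝ≥0∞) ∂timeMeasure ∂P
      + dark * (b - a : ℝ≥0) := by
  have hm : MeasurableSet {ω | Y b ω ≠ Y a ω} :=
    (measurableSet_eq_fun (h.measurable_apply b) (h.measurable_apply a)).compl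
  rw [← h.lintegral_increment a b, ← lintegral_indicator_one hm]
  refine lintegral_mono fun ω => ?_
  by_cases hω : Y b ω ≠ Y a ω
  · have := (h.countingPath ω).mono hab
    have h1 : 1 ≤ Y b ω - Y a ω := by omega
    have h2 : (1 : ℝ≥0∞) ≤ ((Y b ω - Y a ω : ℕ) : ℝ≥0∞) := by exact_mod_cast h1
    simpa [Set.indicator, hω] using h2
  · simp [Set.indicator, hω]

/-- Over a short interval, the law of the increment of the output is that of a Bernoulli variable
of parameter `p = dark * (b - a)`, up to the energy spent on the interval and an error that is of
second order: `φ (Y b)` is compared with `(1 - p) φ (Y a) + p φ (Y a + 1)`. -/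
lemma lintegral_step_le [IsProbabilityMeasure P]
    (h : AdmitsIntensity P F Y (fun t ω => X t ω + dark)) {a b : ℝ≥0} (hab : a ≤ b)
    {φ : Ω → ℕ → ℝ≥0∞} (hφ : ∀ j, Measurable[F a] fun ω => φ ω j) (hφ1 : ∀ ω j, φ ω j ≤ 1) :
    ∫⁻ ω, φ ω (Y b ω) ∂P + (dark * (b - a) : ℝ≥0) * ∫⁻ ω, φ ω (Y a ω) ∂P
      ≤ ∫⁻ ω, φ ω (Y a ω) ∂P + (dark * (b - a) : ℝ≥0) * ∫⁻ ω, φ ω (Y a ω + 1) ∂P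
        + ∫⁻ ω, ∫⁻ t in Set.Ioc a b, (X t ω : ℝ≥0∞) ∂timeMeasure ∂P
        + 2 * (dark * (b - a) : ℝ≥0) * P {ω | Y b ω ≠ Y a ω} := by
  have hφ' : ∀ j, Measurable fun ω => φ ω j := fun j => (hφ j).mono (F.le a) le_rfl
  have hm : MeasurableSet {ω | Y b ω ≠ Y a ω} :=
    (measurableSet_eq_fun (h.measurable_apply b) (h.measurable_apply a)).compl
  have hconst : ∀ ω, ∀ t ∈ Set.Ioc a b, Y b ω = Y a ω → leftVal (fun t => Y t ω) t = Y a ω := by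
    intro ω t ht hω
    have hmono := (h.countingPath ω).mono
    refine le_antisymm ?_ (le_leftVal hmono ht.1)
    exact (leftVal_le hmono t).trans ((hmono ht.2).trans hω.le)
  set E : Set Ω := {ω | Y b ω ≠ Y a ω} with hE
  set J0 := ∫⁻ ω, ∫⁻ t in Set.Ioc a b, φ ω (leftVal (fun t => Y t ω) t) ∂timeMeasure ∂P with hJ0
  set J1 := ∫⁻ ω, ∫⁻ t in Set.Ioc a b, φ ω (leftVal (fun t => Y t ω) t + 1) ∂timeMeasure ∂P
    with hJ1
  set x := ∫⁻ ω, ∫⁻ t in Set.Ioc a b, (X t ω : ℝ≥0∞) ∂timeMeasure ∂P with hx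
  have hvol : timeMeasure (Set.Ioc a b) = ((b - a : ℝ≥0) : ℝ≥0∞) := timeMeasure_Ioc a b
  have hA : (b - a : ℝ≥0) * ∫⁻ ω, φ ω (Y a ω) ∂P ≤ J0 + (b - a : ℝ≥0) * P E := by
    rw [← lintegral_const_mul _ (h.measurable_comp_apply hφ' a), ← lintegral_indicator_one hm,
      ← lintegral_const_mul _ (measurable_one.indicator hm), hJ0,
      ← lintegral_add_right _ ((measurable_one.indicator hm).const_mul _)]
    refine lintegral_mono fun ω => ?_
    rw [mul_comm, ← hvol, ← setLIntegral_const, mul_comm (timeMeasure _), ← setLIntegral_const,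
      ← lintegral_add_right _ measurable_const]
    refine setLIntegral_mono' measurableSet_Ioc fun t ht => ?_
    by_cases hω : Y b ω = Y a ω
    · rw [hconst ω t ht hω]; exact le_self_add
    · simpa [Set.indicator, hE, hω] using (hφ1 ω (Y a ω)).trans le_add_self
  have hB : J1 ≤ (b - a : ℝ≥0) * ∫⁻ ω, φ ω (Y a ω + 1) ∂P + (b - a : ℝ≥0) * P E := by
    rw [← lintegral_const_mul _
        (h.measurable_comp_apply (φ := fun ω j => φ ω (j + 1)) (fun j => hφ' (j + 1)) a),
      ← lintegral_indicator_one hm,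
      ← lintegral_const_mul _ (measurable_one.indicator hm), hJ1,
      ← lintegral_add_right _ ((measurable_one.indicator hm).const_mul _)]
    refine lintegral_mono fun ω => ?_
    rw [mul_comm, ← hvol, ← setLIntegral_const, mul_comm (timeMeasure _), ← setLIntegral_const,
      ← lintegral_add_right _ measurable_const]
    refine setLIntegral_mono' measurableSet_Ioc fun t ht => ?_
    by_cases hω : Y b ω = Y a ω
    · rw [hconst ω t ht hω]; exact le_self_add
    · simpa [Set.indicator, hE, hω] using (hφ1 ω _).trans le_add_self
  have hC : dark * J0 ≤ ∫⁻ ω, ∫⁻ t in Set.Ioc a b,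
        φ ω (leftVal (fun t => Y t ω) t) * ((X t ω + dark : ℝ≥0) : ℝ≥0∞) ∂timeMeasure ∂P := by
    rw [hJ0, ← lintegral_const_mul' _ _ ENNReal.coe_ne_top]
    refine lintegral_mono fun ω => ?_
    rw [← lintegral_const_mul' _ _ ENNReal.coe_ne_top]
    refine lintegral_mono fun t => ?_
    rw [mul_comm]
    gcongr
    exact le_add_self
  have hD : ∫⁻ ω, ∫⁻ t in Set.Ioc a b,
        φ ω (leftVal (fun t => Y t ω) t + 1) * ((X t ω + dark : ℝ≥0) : ℝ≥0∞) ∂timeMeasure ∂P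
      ≤ x + dark * J1 := by
    have hmeas : Measurable fun p : ℝ≥0 × Ω =>
        (Set.Ioc a b).indicator (fun t => φ p.2 (leftVal (fun t => Y t p.2) t + 1)) p.1 :=
      (measurable_predictable_leftVal_comp h.adapted (fun ω => (h.countingPath ω).mono)
        (φ := fun ω j => φ ω (j + 1)) fun j => hφ (j + 1)).mono
        (predictable_le_prod F) le_rfl
    have hJ1' : J1 = ∫⁻ ω, ∫⁻ t, (Set.Ioc a b).indicator
        (fun t => φ ω (leftVal (fun t => Y t ω) t + 1)) t ∂timeMeasure ∂P :=
      lintegral_congr fun ω => (lintegral_indicator measurableSet_Ioc _).symm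
    rw [hJ1', ← lintegral_const_mul' _ _ ENNReal.coe_ne_top, hx, ← lintegral_add_right]
    · refine lintegral_mono fun ω => ?_
      simp only
      rw [← lintegral_const_mul' _ _ ENNReal.coe_ne_top, ← lintegral_indicator measurableSet_Ioc,
        ← lintegral_indicator measurableSet_Ioc, ← lintegral_add_right]
      · refine lintegral_mono fun t => ?_
        by_cases ht : t ∈ Set.Ioc a b
        · simp only [Set.indicator_of_mem ht, ENNReal.coe_add, mul_add]
          rw [mul_comm (dark : ℝ≥0∞)]
          gcongr
          exact mul_le_of_le_one_left zero_le (hφ1 _ _)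
        · simp [ht]
      · exact (hmeas.comp measurable_prodMk_right).const_mul _
    · exact (Measurable.lintegral_prod_right' (f := fun p : Ω × ℝ≥0 => (Set.Ioc a b).indicator
        (fun t => φ p.1 (leftVal (fun t => Y t p.1) t + 1)) p.2)
        (hmeas.comp measurable_swap)).const_mul _
  have hT := h.lintegral_telescope hab hφ
  calc ∫⁻ ω, φ ω (Y b ω) ∂P + (dark * (b - a) : ℝ≥0) * ∫⁻ ω, φ ω (Y a ω) ∂P
      = ∫⁻ ω, φ ω (Y b ω) ∂P + dark * ((b - a : ℝ≥0) * ∫⁻ ω, φ ω (Y a ω) ∂P) := by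
        rw [ENNReal.coe_mul, mul_assoc]
    _ ≤ ∫⁻ ω, φ ω (Y b ω) ∂P + dark * (J0 + (b - a : ℝ≥0) * P E) := by gcongr
    _ = (∫⁻ ω, φ ω (Y b ω) ∂P + dark * J0) + dark * ((b - a : ℝ≥0) * P E) := by
        rw [mul_add, add_assoc]
    _ ≤ (∫⁻ ω, φ ω (Y a ω) ∂P + (x + dark * J1)) + dark * ((b - a : ℝ≥0) * P E) := by
        gcongr ?_ + _
        exact (add_le_add_right hC _).trans (hT.le.trans (add_le_add_right hD _))
    _ ≤ (∫⁻ ω, φ ω (Y a ω) ∂P + (x + dark *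
          ((b - a : ℝ≥0) * ∫⁻ ω, φ ω (Y a ω + 1) ∂P + (b - a : ℝ≥0) * P E)))
          + dark * ((b - a : ℝ≥0) * P E) := by gcongr
    _ = _ := by
        rw [ENNReal.coe_mul]
        ring

end AdmitsIntensity

end OneStep

/-! ### Comparison with a Bernoulli walk along a grid -/

/-- The expectation of `f` after `n` steps of the walk on `ℕ` that increases by one with
probability `p` at each step and stays put otherwise. The argument of `f` is the whole trajectory,
most recent position first, and the walk continues the trajectory `l`. -/
noncomputable def walkExp (p : ℝ≥0∞) (f : List ℕ → ℝ≥0∞) : ℕ → List ℕ → ℝ≥0∞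
  | 0, l => f l
  | n + 1, l => (1 - p) * walkExp p f n (l.headD 0 :: l) + p * walkExp p f n ((l.headD 0 + 1) :: l)

lemma walkExp_le_one {p : ℝ≥0∞} (hp : p ≤ 1) {f : List ℕ → ℝ≥0∞} (hf : ∀ l, f l ≤ 1) (n : ℕ)
    (l : List ℕ) : walkExp p f n l ≤ 1 := by
  induction n generalizing l with
  | zero => exact hf l
  | succ n ih =>
    calc walkExp p f (n + 1) l ≤ (1 - p) * 1 + p * 1 := by
          rw [walkExp]; gcongr <;> exact ih _
      _ = 1 := by rw [mul_one, mul_one, tsub_add_cancel_of_le hp]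

lemma walkExp_sum {ι : Type*} (s : Finset ι) (p : ℝ≥0∞) (f : ι → List ℕ → ℝ≥0∞) (n : ℕ)
    (l : List ℕ) : ∑ i ∈ s, walkExp p (f i) n l = walkExp p (fun l => ∑ i ∈ s, f i l) n l := by
  induction n generalizing l with
  | zero => rfl
  | succ n ih => simp only [walkExp, Finset.sum_add_distrib, ← Finset.mul_sum, ih]

/-- The values of a process at the times `0, δ, …, kδ`, most recent first. -/
def gridHistory {Ω : Type*} (Y : ℝ≥0 → Ω → ℕ) (δ : ℝ≥0) : ℕ → Ω → List ℕ
  | 0, ω => [Y 0 ω]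
  | k + 1, ω => Y ((k + 1 : ℕ) * δ) ω :: gridHistory Y δ k ω

section Walk

variable {Ω : Type*} {Y : ℝ≥0 → Ω → ℕ}

lemma gridHistory_headD (δ : ℝ≥0) (k : ℕ) (ω : Ω) :
    (gridHistory Y δ k ω).headD 0 = Y (k * δ) ω := by
  cases k <;> simp [gridHistory]

lemma gridHistory_eq_iff (δ : ℝ≥0) (n : ℕ) (ω ω' : Ω) :
    gridHistory Y δ n ω = gridHistory Y δ n ω' ↔ ∀ k ≤ n, Y (k * δ) ω = Y (k * δ) ω' := by
  induction n with
  | zero => simp [gridHistory]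
  | succ n ih =>
    simp only [gridHistory, List.cons.injEq, ih]
    constructor
    · rintro ⟨h1, h2⟩ k hk
      rcases Nat.le_succ_iff.1 hk with hk | rfl
      · exact h2 k hk
      · exact h1
    · exact fun h => ⟨h _ le_rfl, fun k hk => h k (hk.trans n.le_succ)⟩

lemma measurable_gridHistory_comp {mΩ : MeasurableSpace Ω} (δ : ℝ≥0) (n : ℕ)
    (hY : ∀ k ≤ n, Measurable (Y (k * δ))) (g : List ℕ → ℝ≥0∞) :
    Measurable fun ω => g (gridHistory Y δ n ω) := by
  induction n generalizing g with
  | zero =>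
    have h0 := hY 0 le_rfl
    simp only [Nat.cast_zero, zero_mul] at h0
    exact (measurable_from_top (f := fun j : ℕ => g [j])).comp h0
  | succ n ih =>
    have h1 : Measurable fun p : ℕ × Ω => g (p.1 :: gridHistory Y δ n p.2) :=
      measurable_from_prod_countable_right fun j =>
        ih (fun k hk => hY k (hk.trans n.le_succ)) fun l => g (j :: l)
    exact h1.comp ((hY _ le_rfl).prodMk measurable_id)

variable {mΩ : MeasurableSpace Ω} {F : Filtration ℝ≥0 mΩ} {P : Measure Ω}
  {X : ℝ≥0 → Ω → ℝ≥0} {dark : ℝ≥0}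

namespace AdmitsIntensity

lemma lintegral_gridHistory_succ_le [IsProbabilityMeasure P]
    (h : AdmitsIntensity P F Y (fun t ω => X t ω + dark)) {δ : ℝ≥0} (hp : dark * δ ≤ 1)
    {g : List ℕ → ℝ≥0∞} (hg : ∀ l, g l ≤ 1) (k : ℕ) :
    ∫⁻ ω, g (gridHistory Y δ (k + 1) ω) ∂P
      ≤ ∫⁻ ω, walkExp (dark * δ : ℝ≥0) g 1 (gridHistory Y δ k ω) ∂P
        + (1 + 2 * (dark * δ : ℝ≥0)) * ∫⁻ ω, ∫⁻ t in Set.Ioc (k * δ) ((k + 1 : ℕ) * δ),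
            (X t ω : ℝ≥0∞) ∂timeMeasure ∂P
        + 2 * (dark * δ : ℝ≥0) * (dark * δ : ℝ≥0) := by
  set p : ℝ≥0∞ := ((dark * δ : ℝ≥0) : ℝ≥0∞) with hpdef
  have hp1 : p ≤ 1 := by simpa [hpdef] using (by exact_mod_cast hp : ((dark * δ : ℝ≥0) : ℝ≥0∞) ≤ 1)
  have hab : (k : ℝ≥0) * δ ≤ (k + 1 : ℕ) * δ := by gcongr; simp
  have hδ : ((k + 1 : ℕ) : ℝ≥0) * δ - k * δ = δ := by
    rw [← tsub_mul]; simp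
  have hmeas : ∀ (g : List ℕ → ℝ≥0∞), Measurable[F (k * δ)] fun ω => g (gridHistory Y δ k ω) :=
    fun g => measurable_gridHistory_comp (mΩ := F (k * δ)) δ k
      (fun i hi => (h.adapted _).mono (F.mono (by gcongr)) le_rfl) g
  have hstep := h.lintegral_step_le hab (φ := fun ω j => g (j :: gridHistory Y δ k ω))
    (fun j => hmeas fun l => g (j :: l)) (fun _ _ => hg _)
  have hne := h.measure_ne_le hab
  rw [hδ] at hstep hne
  rw [← ENNReal.coe_mul] at hne
  rw [← hpdef] at hstep hne
  set x := ∫⁻ ω, ∫⁻ t in Set.Ioc (k * δ) ((k + 1 : ℕ) * δ), (X t ω : ℝ≥0∞) ∂timeMeasure ∂P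
  set B := ∫⁻ ω, g (Y (k * δ) ω :: gridHistory Y δ k ω) ∂P with hB
  set C := ∫⁻ ω, g ((Y (k * δ) ω + 1) :: gridHistory Y δ k ω) ∂P with hC
  have hB1 : B ≤ 1 := by
    calc B ≤ ∫⁻ _, 1 ∂P := lintegral_mono fun ω => hg _
      _ = 1 := by simp
  have hmB : Measurable fun ω => g (Y (k * δ) ω :: gridHistory Y δ k ω) := by
    have := (hmeas fun l => g (l.headD 0 :: l)).mono (F.le _) le_rfl
    simpa only [gridHistory_headD] using this
  have hmC : Measurable fun ω => g ((Y (k * δ) ω + 1) :: gridHistory Y δ k ω) := by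
    have := (hmeas fun l => g ((l.headD 0 + 1) :: l)).mono (F.le _) le_rfl
    simpa only [gridHistory_headD] using this
  have hW : ∫⁻ ω, walkExp p g 1 (gridHistory Y δ k ω) ∂P = (1 - p) * B + p * C := by
    simp only [walkExp, gridHistory_headD]
    rw [lintegral_add_left (hmB.const_mul _), lintegral_const_mul _ hmB, lintegral_const_mul _ hmC]
  have hBp : B = (1 - p) * B + p * B := by rw [← add_mul, tsub_add_cancel_of_le hp1, one_mul]
  have hfin : p * B ≠ ∞ := ENNReal.mul_ne_top ENNReal.coe_ne_top (hB1.trans_lt ENNReal.one_lt_top).ne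
  rw [hW]
  refine (ENNReal.add_le_add_iff_right hfin).1 ?_
  calc ∫⁻ ω, g (gridHistory Y δ (k + 1) ω) ∂P + p * B
      ≤ B + p * C + x + 2 * p * P {ω | Y ((k + 1 : ℕ) * δ) ω ≠ Y (k * δ) ω} := hstep
    _ ≤ B + p * C + x + 2 * p * (x + p) := by gcongr
    _ = ((1 - p) * B + p * B) + p * C + x + 2 * p * (x + p) := by rw [← hBp]
    _ = _ := by ring

/-- The one-step comparison summed along the grid. The energies of the steps add up to the energy of
the whole interval, and the second-order errors to `n` times a square. -/
lemma lintegral_gridHistory_le [IsProbabilityMeasure P]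
    (h : AdmitsIntensity P F Y (fun t ω => X t ω + dark)) {δ : ℝ≥0} (hp : dark * δ ≤ 1)
    {f : List ℕ → ℝ≥0∞} (hf : ∀ l, f l ≤ 1) (n k : ℕ) :
    ∫⁻ ω, f (gridHistory Y δ (k + n) ω) ∂P
      ≤ ∫⁻ ω, walkExp (dark * δ : ℝ≥0) f n (gridHistory Y δ k ω) ∂P
        + (1 + 2 * (dark * δ : ℝ≥0)) * ∫⁻ ω, ∫⁻ t in Set.Ioc (k * δ) ((k + n : ℕ) * δ),
            (X t ω : ℝ≥0∞) ∂timeMeasure ∂P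
        + n * (2 * (dark * δ : ℝ≥0) * (dark * δ : ℝ≥0)) := by
  have hp1 : ((dark * δ : ℝ≥0) : ℝ≥0∞) ≤ 1 := by exact_mod_cast hp
  induction n generalizing k with
  | zero => simp [walkExp]
  | succ n ih =>
    have h1 := ih (k + 1)
    have h2 := h.lintegral_gridHistory_succ_le hp (walkExp_le_one hp1 hf n) k
    have h3 : ∫⁻ ω, ∫⁻ t in Set.Ioc (k * δ) ((k + 1 : ℕ) * δ), (X t ω : ℝ≥0∞) ∂timeMeasure ∂P
        + ∫⁻ ω, ∫⁻ t in Set.Ioc ((k + 1 : ℕ) * δ) ((k + 1 + n : ℕ) * δ),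
            (X t ω : ℝ≥0∞) ∂timeMeasure ∂P
        ≤ ∫⁻ ω, ∫⁻ t in Set.Ioc (k * δ) ((k + 1 + n : ℕ) * δ),
            (X t ω : ℝ≥0∞) ∂timeMeasure ∂P := by
      refine (le_lintegral_add _ _).trans (lintegral_mono fun ω => ?_)
      simp only
      rw [← lintegral_union measurableSet_Ioc]
      · rw [Set.Ioc_union_Ioc_eq_Ioc]
        · gcongr; simp
        · gcongr ?_ * _
          exact_mod_cast Nat.le_add_right _ _
      · exact Set.Ioc_disjoint_Ioc_of_le le_rfl
    rw [show k + (n + 1) = k + 1 + n by ring]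
    have h4 : ∀ l, walkExp ((dark * δ : ℝ≥0) : ℝ≥0∞) f (n + 1) l
        = walkExp (dark * δ : ℝ≥0) (walkExp (dark * δ : ℝ≥0) f n) 1 l := fun l => rfl
    simp only [h4]
    refine (h1.trans (add_le_add_left (add_le_add_left h2 _) _)).trans ?_
    refine le_trans (le_of_eq ?_) (add_le_add_left (add_le_add_right (mul_le_mul_right h3 _) _) _)
    push_cast
    ring

/-- Comparison of the law of the sampled output with that of the Bernoulli walk with the same mean
as the dark current: the two differ by at most the expected energy, up to an error which vanishes
with the mesh of the grid. -/
lemma lintegral_gridHistory_le_walkExp [IsProbabilityMeasure P]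
    (h : AdmitsIntensity P F Y (fun t ω => X t ω + dark)) {δ : ℝ≥0} (hp : dark * δ ≤ 1)
    {f : List ℕ → ℝ≥0∞} (hf : ∀ l, f l ≤ 1) (n : ℕ) :
    ∫⁻ ω, f (gridHistory Y δ n ω) ∂P
      ≤ walkExp (dark * δ : ℝ≥0) f n [0]
        + (1 + 2 * (dark * δ : ℝ≥0)) * ∫⁻ ω, ∫⁻ t in Set.Iic (n * δ),
            (X t ω : ℝ≥0∞) ∂timeMeasure ∂P
        + n * (2 * (dark * δ : ℝ≥0) * (dark * δ : ℝ≥0)) := by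
  have h1 := h.lintegral_gridHistory_le hp hf n 0
  have h0 : ∀ ω, gridHistory Y δ 0 ω = [0] := fun ω => by
    simp [gridHistory, (h.countingPath ω).zero]
  simp only [h0, lintegral_const, measure_univ, mul_one, zero_add] at h1
  refine h1.trans ?_
  gcongr
  exact Set.Ioc_subset_Iic_self

end AdmitsIntensity

end Walk

/-! ### Approximation of the decision regions by finite-dimensional events -/

section Approximation

variable {Ω : Type*} {mΩ : MeasurableSpace Ω} {Y : ℝ≥0 → Ω → ℕ} {T : ℝ≥0}

lemma tendsto_div_two_pow (T : ℝ≥0) :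
    Filter.Tendsto (fun N : ℕ => T / 2 ^ N) Filter.atTop (nhds 0) := by
  have h := tendsto_pow_atTop_nhds_zero_of_lt_one (r := (1 / 2 : ℝ≥0)) (by simp)
    (by rw [div_lt_one] <;> norm_num)
  simpa [div_eq_mul_inv] using Filter.Tendsto.const_mul T h

/-- The trajectories of two sample points agree at the times `k T / 2 ^ N`, `k ≤ 2 ^ N`. -/
def AgreeOnGrid (Y : ℝ≥0 → Ω → ℕ) (T : ℝ≥0) (N : ℕ) (ω ω' : Ω) : Prop :=
  ∀ k : ℕ, k ≤ 2 ^ N → Y (k * (T / 2 ^ N)) ω = Y (k * (T / 2 ^ N)) ω'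

lemma AgreeOnGrid.mono {N N' : ℕ} (hN : N ≤ N') {ω ω' : Ω} (h : AgreeOnGrid Y T N' ω ω') :
    AgreeOnGrid Y T N ω ω' := by
  intro k hk
  obtain ⟨d, rfl⟩ := Nat.exists_eq_add_of_le hN
  have := h (k * 2 ^ d) (by rw [pow_add]; gcongr)
  have h2 : ((k * 2 ^ d : ℕ) : ℝ≥0) * (T / 2 ^ (N + d)) = k * (T / 2 ^ N) := by
    push_cast; rw [pow_add]; field_simp
  rwa [h2] at this

/-- The events that depend on the values of the process at finitely many dyadic times. -/
def gridEvents (Y : ℝ≥0 → Ω → ℕ) (T : ℝ≥0) : Set (Set Ω) :=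
  {B | ∃ N, ∀ ω ω', AgreeOnGrid Y T N ω ω' → ω ∈ B → ω' ∈ B}

lemma AgreeOnGrid.symm {N : ℕ} {ω ω' : Ω} (h : AgreeOnGrid Y T N ω ω') : AgreeOnGrid Y T N ω' ω :=
  fun k hk => (h k hk).symm

lemma isSetAlgebra_gridEvents : IsSetAlgebra (gridEvents Y T) where
  empty_mem := ⟨0, fun _ _ _ h => h⟩
  compl_mem := by
    rintro s ⟨N, h⟩
    exact ⟨N, fun ω ω' hω hs hs' => hs (h _ _ hω.symm hs')⟩
  union_mem := by
    rintro s t ⟨N, h⟩ ⟨N', h'⟩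
    refine ⟨max N N', fun ω ω' hω => Or.imp (h _ _ ?_) (h' _ _ ?_)⟩
    · exact hω.mono (le_max_left _ _)
    · exact hω.mono (le_max_right _ _)

lemma exists_preimage_gridHistory {B : Set Ω} {N : ℕ}
    (hB : ∀ ω ω', AgreeOnGrid Y T N ω ω' → ω ∈ B → ω' ∈ B) :
    ∃ S : Set (List ℕ), B = gridHistory Y (T / 2 ^ N) (2 ^ N) ⁻¹' S := by
  refine ⟨gridHistory Y (T / 2 ^ N) (2 ^ N) '' B, Set.Subset.antisymm (Set.subset_preimage_image _ _) ?_⟩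
  rintro ω' ⟨ω, hω, h⟩
  exact hB ω ω' ((gridHistory_eq_iff _ _ _ _).1 h) hω

lemma measurableSet_preimage_gridHistory (hY : ∀ t, Measurable (Y t)) (δ : ℝ≥0) (n : ℕ)
    (S : Set (List ℕ)) : MeasurableSet (gridHistory Y δ n ⁻¹' S) := by
  have h := measurable_gridHistory_comp δ n (fun k _ => hY (k * δ)) (S.indicator 1)
  have h2 : gridHistory Y δ n ⁻¹' S
      = (fun ω => S.indicator (1 : List ℕ → ℝ≥0∞) (gridHistory Y δ n ω)) ⁻¹' {1} := by
    ext ω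
    by_cases hω : gridHistory Y δ n ω ∈ S <;> simp [hω]
  rw [h2]
  exact h (measurableSet_singleton 1)

lemma generateFrom_gridEvents_le (hY : ∀ t, Measurable (Y t)) :
    MeasurableSpace.generateFrom (gridEvents Y T) ≤ mΩ := by
  refine MeasurableSpace.generateFrom_le ?_
  rintro B ⟨N, hB⟩
  obtain ⟨S, rfl⟩ := exists_preimage_gridHistory hB
  exact measurableSet_preimage_gridHistory hY _ _ S

/-- By right-continuity, the values at the dyadic times determine the path on `[0, T]`. -/
lemma measurable_generateFrom_gridEvents (hpath : ∀ ω, IsCountingPath fun t => Y t ω)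
    (hT : 0 < T) {t : ℝ≥0} (ht : t ≤ T) :
    Measurable[MeasurableSpace.generateFrom (gridEvents Y T)] (Y t) := by
  have hgrid : ∀ N k : ℕ, k ≤ 2 ^ N →
      Measurable[MeasurableSpace.generateFrom (gridEvents Y T)] (Y (k * (T / 2 ^ N))) := by
    intro N k hk S _
    refine MeasurableSpace.measurableSet_generateFrom ⟨N, fun ω ω' h hω => ?_⟩
    simpa [← h k hk] using hω
  -- the first point of the `N`-th grid at or after `t`
  set k : ℕ → ℕ := fun N => ⌈t * 2 ^ N / T⌉₊ with hk
  set u : ℕ → ℝ≥0 := fun N => k N * (T / 2 ^ N) with hu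
  have hkle : ∀ N, k N ≤ 2 ^ N := by
    intro N
    refine Nat.ceil_le.2 ?_
    rw [div_le_iff₀ hT, mul_comm]
    push_cast
    gcongr
  have hge : ∀ N, t ≤ u N := by
    intro N
    have h1 : t * 2 ^ N / T ≤ k N := Nat.le_ceil _
    calc t = t * 2 ^ N / T * (T / 2 ^ N) := by field_simp
      _ ≤ k N * (T / 2 ^ N) := by gcongr
  have hle : ∀ N, u N ≤ t + T / 2 ^ N := by
    intro N
    have h1 : (k N : ℝ≥0) ≤ t * 2 ^ N / T + 1 := (Nat.ceil_lt_add_one zero_le).le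
    calc k N * (T / 2 ^ N) ≤ (t * 2 ^ N / T + 1) * (T / 2 ^ N) := by gcongr
      _ = t + T / 2 ^ N := by field_simp
  have hlim : Filter.Tendsto u Filter.atTop (nhds t) := by
    refine tendsto_of_tendsto_of_tendsto_of_le_of_le tendsto_const_nhds ?_ hge hle
    simpa using tendsto_const_nhds.add (tendsto_div_two_pow T)
  have hlim' : Filter.Tendsto u Filter.atTop (nhdsWithin t (Set.Ici t)) :=
    tendsto_nhdsWithin_iff.2 ⟨hlim, Filter.Eventually.of_forall hge⟩
  let : MeasurableSpace Ω := MeasurableSpace.generateFrom (gridEvents Y T)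
  refine measurable_of_tendsto_metrizable (f := fun N => Y (u N)) (fun N => hgrid N _ (hkle N)) ?_
  rw [tendsto_pi_nhds]
  exact fun ω => ((hpath ω).rightCont t).tendsto.comp hlim'

/-- Every event of the output on `[0, T]` is approximated by events of the output sampled on a fine
dyadic grid. -/
lemma eventually_exists_gridHistory_approx (hpath : ∀ ω, IsCountingPath fun t => Y t ω)
    (hY : ∀ t, Measurable (Y t)) (hT : 0 < T) (μ : Measure Ω) [IsFiniteMeasure μ]
    {D : Set (Set.Iic T → ℕ)} (hD : MeasurableSet D) {η : ℝ} (hη : 0 < η) :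
    ∀ᶠ N : ℕ in Filter.atTop, ∃ S : Set (List ℕ),
      μ (symmDiff {ω | (fun t : Set.Iic T => Y t ω) ∈ D}
        (gridHistory Y (T / 2 ^ N) (2 ^ N) ⁻¹' S)) ≤ ENNReal.ofReal η := by
  set m' := MeasurableSpace.generateFrom (gridEvents Y T) with hm'
  have hle : m' ≤ mΩ := generateFrom_gridEvents_le hY
  have hA : MeasurableSet[m'] {ω | (fun t : Set.Iic T => Y t ω) ∈ D} := by
    have : Measurable[m'] fun ω => fun t : Set.Iic T => Y t ω :=
      @measurable_pi_lambda _ _ _ m' _ _ fun t =>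
        measurable_generateFrom_gridEvents hpath hT t.2
    exact this hD
  have hdense := @Measure.MeasureDense.of_generateFrom_isSetAlgebra_finite Ω m' (μ.trim hle)
    (gridEvents Y T) _ isSetAlgebra_gridEvents rfl
  obtain ⟨B, ⟨N₀, hB⟩, hlt⟩ := hdense.approx _ hA (measure_ne_top _ _) η hη
  filter_upwards [Filter.eventually_ge_atTop N₀] with N hN
  obtain ⟨S, rfl⟩ := exists_preimage_gridHistory (N := N) (T := T) (Y := Y) (B := B)
    fun ω ω' h => hB ω ω' (h.mono hN)
  exact ⟨S, (le_trim hle).trans hlt.le⟩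

end Approximation

/-! ### The converse -/

namespace FeedbackScheme

variable {M : ℕ} {dark : ℝ≥0}

lemma measurable_output (S : FeedbackScheme.{u} M dark) (m : Fin M) (t : ℝ≥0) :
    Measurable[S.mΩ] (S.Y t) :=
  (S.channel m).measurable_apply t

lemma one_eq_success_add_messageError (S : FeedbackScheme.{u} M dark) (m : Fin M) :
    letI := S.mΩ
    1 = S.P m {ω | S.decode (fun t => S.Y t ω) = m} + S.messageError m := by
  let := S.mΩ
  have := S.prob m
  have hm : MeasurableSet {ω | S.decode (fun t => S.Y t ω) = m} :=
    (S.decode_measurable.comp (measurable_pi_lambda _ fun t => S.measurable_output m t))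
      (measurableSet_singleton m)
  rw [messageError, ← measure_univ (μ := S.P m), ← measure_add_measure_compl hm]
  rfl

/-- The converse before the mesh of the grid and the approximation error are sent to zero. -/
lemma eventually_card_le (S : FeedbackScheme.{u} M dark) {η : ℝ} (hη : 0 < η) :
    ∀ᶠ N : ℕ in Filter.atTop, (M : ℝ≥0∞) ≤
      (1 + (1 + 2 * (dark * (S.T / 2 ^ N) : ℝ≥0)) * ∑ m, S.messageEnergy m
        + M * (2 * (dark * S.T : ℝ≥0) * (dark * (S.T / 2 ^ N) : ℝ≥0))
        + M * (M * ENNReal.ofReal η)) + ∑ m, S.messageError m := by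
  let := S.mΩ
  rcases Nat.eq_zero_or_pos M with rfl | hM
  · simp
  have hprob := S.prob
  have hpath : ∀ ω, IsCountingPath fun t => S.Y t ω := (S.channel ⟨0, hM⟩).countingPath
  have hY : ∀ t, Measurable (S.Y t) := S.measurable_output ⟨0, hM⟩
  set μ : Measure S.Ω := Measure.sum S.P with hμ
  have hμfin : IsFiniteMeasure μ := by
    constructor
    rw [hμ, Measure.sum_apply _ MeasurableSet.univ, tsum_fintype]
    simp
  have hPμ : ∀ m, S.P m ≤ μ := Measure.le_sum S.P
  have happrox : ∀ m : Fin M, ∀ᶠ N : ℕ in Filter.atTop, ∃ R : Set (List ℕ),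
      μ (symmDiff {ω | (fun t : Set.Iic S.T => S.Y t ω) ∈ S.decode ⁻¹' {m}}
        (gridHistory S.Y (S.T / 2 ^ N) (2 ^ N) ⁻¹' R)) ≤ ENNReal.ofReal η := fun m =>
    eventually_exists_gridHistory_approx hpath hY S.T_pos μ
      (S.decode_measurable (measurableSet_singleton m)) hη
  have hsmall : ∀ᶠ N : ℕ in Filter.atTop, dark * (S.T / 2 ^ N) ≤ 1 := by
    have h0 : Filter.Tendsto (fun N : ℕ => dark * (S.T / 2 ^ N)) Filter.atTop (nhds 0) := by
      simpa using Filter.Tendsto.const_mul dark (tendsto_div_two_pow S.T)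
    exact h0.eventually_le_const one_pos
  filter_upwards [Filter.eventually_all.2 happrox, hsmall] with N hN hp
  choose R hR using hN
  set δ : ℝ≥0 := S.T / 2 ^ N with hδ
  set H := gridHistory S.Y δ (2 ^ N) with hH
  have hnδ : ((2 ^ N : ℕ) : ℝ≥0) * δ = S.T := by rw [hδ]; push_cast; field_simp
  set A : Fin M → Set S.Ω := fun m => {ω | S.decode (fun t => S.Y t ω) = m} with hA
  -- the approximating decision regions, made disjoint
  set R' : Fin M → Set (List ℕ) := fun m => {l | l ∈ R m ∧ ∀ j < m, l ∉ R j} with hR'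
  set f : Fin M → List ℕ → ℝ≥0∞ := fun m => (R' m).indicator 1 with hf
  have hf1 : ∀ m l, f m l ≤ 1 := fun m l => Set.indicator_le_self' (fun _ _ => zero_le) l
  have hfsum : ∀ l, ∑ m, f m l ≤ 1 := by
    intro l
    by_cases hl : ∃ m, l ∈ R' m
    · obtain ⟨m, hm⟩ := hl
      rw [Finset.sum_eq_single m]
      · exact hf1 m l
      · intro j _ hj
        refine Set.indicator_of_notMem (fun hj' => ?_) _
        rcases lt_or_gt_of_ne hj with h | h
        · exact hm.2 j h hj'.1
        · exact hj'.2 m h hm.1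
      · simp
    · push Not at hl
      simp [hf, hl]
  have hsucc : ∀ m, S.P m (A m) ≤ walkExp (dark * δ : ℝ≥0) (f m) (2 ^ N) [0]
      + (1 + 2 * (dark * δ : ℝ≥0)) * S.messageEnergy m
      + 2 * (dark * S.T : ℝ≥0) * (dark * δ : ℝ≥0) + M * ENNReal.ofReal η := by
    intro m
    have hsub : A m ⊆ H ⁻¹' R' m ∪ ⋃ j, symmDiff (A j) (H ⁻¹' R j) := by
      intro ω hω
      by_cases hmem : H ω ∈ R' m
      · exact Or.inl hmem
      refine Or.inr (Set.mem_iUnion.2 ?_)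
      by_cases hm : H ω ∈ R m
      · have : ∃ j < m, H ω ∈ R j := by
          by_contra! hc
          exact hmem ⟨hm, hc⟩
        obtain ⟨j, hj, hj'⟩ := this
        refine ⟨j, Or.inr ⟨hj', fun h => hj.ne' ?_⟩⟩
        exact (show S.decode _ = m from hω).symm.trans h
      · exact ⟨m, Or.inl ⟨hω, hm⟩⟩
    have h1 : S.P m (H ⁻¹' R' m) = ∫⁻ ω, f m (H ω) ∂(S.P m) := by
      rw [← lintegral_indicator_one (measurableSet_preimage_gridHistory hY _ _ _)]
      rfl
    have h2 := (S.channel m).lintegral_gridHistory_le_walkExp hp (hf1 m) (2 ^ N)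
    rw [hnδ] at h2
    have h3 : ((2 ^ N : ℕ) : ℝ≥0∞) * (2 * ((dark * δ : ℝ≥0) : ℝ≥0∞) * ((dark * δ : ℝ≥0) : ℝ≥0∞))
        = 2 * (dark * S.T : ℝ≥0) * (dark * δ : ℝ≥0) := by
      rw [← hnδ]; push_cast; ring
    rw [h3] at h2
    calc S.P m (A m) ≤ S.P m (H ⁻¹' R' m) + ∑ j, S.P m (symmDiff (A j) (H ⁻¹' R j)) := by
          refine (measure_mono hsub).trans ((measure_union_le _ _).trans ?_)
          gcongr
          exact measure_iUnion_fintype_le _ _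
      _ ≤ _ + ∑ _j : Fin M, ENNReal.ofReal η := by
          gcongr with j
          exact ((hPμ m) _).trans (hR j)
      _ ≤ _ := by
          rw [h1]
          simp only [Finset.sum_const, Finset.card_univ, Fintype.card_fin, nsmul_eq_mul]
          gcongr
          exact h2
  calc (M : ℝ≥0∞) = ∑ m : Fin M, (S.P m (A m) + S.messageError m) := by
        rw [← Finset.sum_congr rfl fun m _ => S.one_eq_success_add_messageError m]
        simp
    _ = ∑ m, S.P m (A m) + ∑ m, S.messageError m := Finset.sum_add_distrib
    _ ≤ _ := by
        gcongr
        refine (Finset.sum_le_sum fun m _ => hsucc m).trans ?_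
        simp only [Finset.sum_add_distrib, Finset.sum_const, Finset.card_univ,
          Fintype.card_fin, nsmul_eq_mul]
        rw [← Finset.mul_sum]
        gcongr
        rw [walkExp_sum]
        exact walkExp_le_one (by exact_mod_cast hp) hfsum _ _

/-- The success probabilities sum up to at most `1` plus the sum of the energies: the output law
given any message differs from the law of the dark current by at most the energy spent. -/
theorem card_le_one_add_sum_messageEnergy (S : FeedbackScheme.{u} M dark) :
    (M : ℝ≥0∞) ≤ 1 + ∑ m, S.messageEnergy m + ∑ m, S.messageError m := by
  by_cases hE : ∑ m, S.messageEnergy m = ∞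
  · simp [hE]
  have hlim : Filter.Tendsto (fun N : ℕ => ((dark * (S.T / 2 ^ N) : ℝ≥0) : ℝ≥0∞)) Filter.atTop
      (nhds 0) := by
    rw [← ENNReal.coe_zero, ENNReal.tendsto_coe]
    simpa using Filter.Tendsto.const_mul dark (tendsto_div_two_pow S.T)
  have key : ∀ η : ℝ, 0 < η → (M : ℝ≥0∞) ≤
      1 + ∑ m, S.messageEnergy m + M * (M * ENNReal.ofReal η) + ∑ m, S.messageError m := by
    intro η hη
    refine ge_of_tendsto ?_ (S.eventually_card_le hη)
    have h1 : Filter.Tendsto (fun N : ℕ =>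
        (1 + 2 * ((dark * (S.T / 2 ^ N) : ℝ≥0) : ℝ≥0∞)) * ∑ m, S.messageEnergy m) Filter.atTop
        (nhds (∑ m, S.messageEnergy m)) := by
      have h := ENNReal.Tendsto.const_mul (a := 2) hlim (Or.inr (by simp))
      have h' := ENNReal.Tendsto.mul_const (b := ∑ m, S.messageEnergy m)
        (tendsto_const_nhds (x := (1 : ℝ≥0∞)) |>.add h) (Or.inr hE)
      simpa using h'
    have h2 : Filter.Tendsto (fun N : ℕ => (M : ℝ≥0∞) *
        (2 * ((dark * S.T : ℝ≥0) : ℝ≥0∞) * ((dark * (S.T / 2 ^ N) : ℝ≥0) : ℝ≥0∞))) Filter.atTop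
        (nhds 0) := by
      have h := ENNReal.Tendsto.const_mul (a := 2 * ((dark * S.T : ℝ≥0) : ℝ≥0∞)) hlim
        (Or.inr (by finiteness))
      have h' := ENNReal.Tendsto.const_mul (a := (M : ℝ≥0∞)) h (Or.inr (by finiteness))
      simpa using h'
    have h3 := (((tendsto_const_nhds (x := (1 : ℝ≥0∞))).add h1).add h2).add
      (tendsto_const_nhds (x := (M : ℝ≥0∞) * (M * ENNReal.ofReal η)))
    simpa using h3.add (tendsto_const_nhds (x := ∑ m, S.messageError m))
  refine ENNReal.le_of_forall_pos_le_add fun ε hε _ => ?_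
  have hη : 0 < (ε : ℝ) / (M * M + 1) := by positivity
  refine (key _ hη).trans ?_
  rw [add_right_comm]
  gcongr
  rw [← ENNReal.ofReal_natCast, ← ENNReal.ofReal_mul (by positivity),
    ← ENNReal.ofReal_mul (by positivity), ← ENNReal.ofReal_coe_nnreal]
  refine ENNReal.ofReal_le_ofReal ?_
  rw [← mul_assoc, mul_div_assoc', div_le_iff₀ (by positivity)]
  nlinarith [ε.2]

end FeedbackScheme

/-- No energy below `(M - 1) / M` suffices. -/
theorem le_of_reliablyTransmittable {M : ℕ} (hM : 1 ≤ M) {dark : ℝ≥0} {E : ℝ≥0∞}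
    (hE : ReliablyTransmittable.{u} M dark E) : ((M : ℝ≥0∞) - 1) / M ≤ E := by
  have hM0 : (M : ℝ≥0∞) ≠ 0 := by simp; omega
  refine ENNReal.le_of_forall_pos_le_add fun ε hε _ => ?_
  obtain ⟨S, rfl, herr⟩ := hE ε (by exact_mod_cast hε)
  refine le_trans ?_ (add_le_add_right herr.le _)
  rw [FeedbackScheme.energy, FeedbackScheme.errorProb, ← ENNReal.add_div]
  gcongr
  rw [tsub_le_iff_left, ← add_assoc]
  exact S.card_le_one_add_sum_messageEnergy

/-! ### Point processes given by a countable family of random times -/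

section JumpTimes

variable {Ω : Type*} {ι : Type*} {T : ι → Ω → ℝ≥0}

/-- The sample points at which the times `T i` are positive, pairwise distinct and without
accumulation point. -/
def goodSet (T : ι → Ω → ℝ≥0) : Set Ω :=
  {ω | (∀ i, 0 < T i ω) ∧ Function.Injective (fun i => T i ω) ∧ ∀ t, {i | T i ω ≤ t}.Finite}

open scoped Classical in
/-- The number of indices `i` with `T i ≤ t`. It is set to `0` off `goodSet T`, so that all the
paths are counting paths. -/
noncomputable def jumpCount (T : ι → Ω → ℝ≥0) (t : ℝ≥0) (ω : Ω) : ℕ :=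
  if ω ∈ goodSet T then {i | T i ω ≤ t}.ncard else 0

lemma jumpCount_of_mem {ω : Ω} (hω : ω ∈ goodSet T) (t : ℝ≥0) :
    jumpCount T t ω = {i | T i ω ≤ t}.ncard := if_pos hω

lemma jumpCount_of_notMem {ω : Ω} (hω : ω ∉ goodSet T) (t : ℝ≥0) : jumpCount T t ω = 0 :=
  if_neg hω

/-- Shortly before `t`, all the times smaller than `t` have occurred. -/
lemma exists_lt_of_mem_goodSet {ω : Ω} (hω : ω ∈ goodSet T) {t : ℝ≥0} (ht : 0 < t) :
    ∃ s < t, ∀ i, T i ω < t → T i ω ≤ s := by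
  have hfin : {i | T i ω < t}.Finite := (hω.2.2 t).subset fun i (hi : T i ω < t) => (hi.le :)
  have h1 : ∀ᶠ s in nhdsWithin t (Set.Iio t), ∀ i ∈ {i | T i ω < t}, T i ω ≤ s := by
    rw [hfin.eventually_all]
    intro i hi
    exact nhdsWithin_le_nhds (eventually_ge_nhds hi)
  have : (nhdsWithin t (Set.Iio t)).NeBot := nhdsLT_neBot_of_exists_lt ⟨0, ht⟩
  obtain ⟨s, hs, hst⟩ := (h1.and self_mem_nhdsWithin).exists
  exact ⟨s, hst, hs⟩

lemma isCountingPath_jumpCount (T : ι → Ω → ℝ≥0) (ω : Ω) :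
    IsCountingPath fun t => jumpCount T t ω := by
  by_cases hω : ω ∈ goodSet T
  swap
  · simp only [jumpCount_of_notMem hω]
    exact ⟨rfl, monotone_const, fun _ => continuousWithinAt_const, fun t ht => ⟨0, ht, by simp⟩⟩
  simp only [jumpCount_of_mem hω]
  refine ⟨?_, ?_, ?_, ?_⟩
  · have : {i | T i ω ≤ 0} = ∅ := by
      ext i; simpa using (hω.1 i).ne'
    rw [this, Set.ncard_empty]
  · intro s t hst
    exact Set.ncard_le_ncard (fun i hi => le_trans hi hst) (hω.2.2 t)
  · intro t
    have hfin : {i | t < T i ω ∧ T i ω ≤ t + 1}.Finite := (hω.2.2 (t + 1)).subset fun i hi => hi.2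
    have h1 : ∀ᶠ s in nhdsWithin t (Set.Ici t), ∀ i ∈ {i | t < T i ω ∧ T i ω ≤ t + 1}, s < T i ω := by
      rw [hfin.eventually_all]
      intro i hi
      exact nhdsWithin_le_nhds (eventually_lt_nhds hi.1)
    have h2 : ∀ᶠ s in nhdsWithin t (Set.Ici t), s < t + 1 :=
      nhdsWithin_le_nhds (eventually_lt_nhds (by simp))
    refine (tendsto_const_nhds (x := {i | T i ω ≤ t}.ncard)).congr' ?_
    filter_upwards [h1, h2, self_mem_nhdsWithin] with s hs hs1 hts
    congr 1
    ext i
    refine ⟨fun hi => le_trans (show T i ω ≤ t from hi) hts, fun (hi : T i ω ≤ s) => ?_⟩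
    by_contra hc
    exact absurd (hs i ⟨not_le.1 hc, hi.trans hs1.le⟩) (not_lt.2 hi)
  · intro t ht
    obtain ⟨s, hst, hs⟩ := exists_lt_of_mem_goodSet hω ht
    refine ⟨s, hst, ?_⟩
    have hsub : {i | T i ω ≤ t} ⊆ {i | T i ω ≤ s} ∪ {i | T i ω = t} := by
      intro i hi
      rcases lt_or_eq_of_le (show T i ω ≤ t from hi) with h | h
      · exact Or.inl (hs i h)
      · exact Or.inr h
    have hsub1 : {i | T i ω = t}.Subsingleton := fun i hi j hj => hω.2.1 (hi.trans hj.symm)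
    have := hsub1.finite.to_subtype
    calc {i | T i ω ≤ t}.ncard ≤ ({i | T i ω ≤ s} ∪ {i | T i ω = t}).ncard :=
          Set.ncard_le_ncard hsub ((hω.2.2 s).union hsub1.finite)
      _ ≤ {i | T i ω ≤ s}.ncard + {i | T i ω = t}.ncard := Set.ncard_union_le _ _
      _ ≤ _ := by
          gcongr
          exact Set.ncard_le_one_iff_subsingleton.2 hsub1

lemma countTimes_jumpCount {ω : Ω} (hω : ω ∈ goodSet T) :
    countTimes (fun t => jumpCount T t ω) = Set.range fun i => T i ω := by
  ext t
  simp only [countTimes, jumpCount_of_mem hω, Set.mem_ofPred_eq, Set.mem_range]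
  constructor
  · rintro ⟨ht, h⟩
    obtain ⟨s, hst, hs⟩ := exists_lt_of_mem_goodSet hω ht
    by_contra! hc
    refine absurd (h s hst) (not_lt.2 (Set.ncard_le_ncard (fun i hi => ?_) (hω.2.2 s)))
    exact hs i (lt_of_le_of_ne hi (hc i))
  · rintro ⟨i, rfl⟩
    refine ⟨hω.1 i, fun s hs => Set.ncard_lt_ncard ?_ (hω.2.2 _)⟩
    refine ⟨fun j hj => le_trans hj hs.le, fun h => ?_⟩
    exact absurd (h (show T i ω ≤ T i ω from le_rfl)) (not_le.2 hs)

lemma countIntegral_jumpCount {ω : Ω} (hω : ω ∈ goodSet T) (c : ℝ≥0 → ℝ≥0∞) :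
    countIntegral c (fun t => jumpCount T t ω) = ∑' i, c (T i ω) := by
  rw [countIntegral, countTimes_jumpCount hω]
  exact tsum_range c hω.2.1

variable {mΩ : MeasurableSpace Ω}

lemma tsum_indicator_eq_encard (T : ι → Ω → ℝ≥0) (t : ℝ≥0) (ω : Ω) :
    ∑' i, {ω | T i ω ≤ t}.indicator (1 : Ω → ℝ≥0∞) ω = {i | T i ω ≤ t}.encard := by
  rw [← ENNReal.tsum_set_one, tsum_subtype {i | T i ω ≤ t} fun _ => (1 : ℝ≥0∞)]
  rfl

lemma coe_ncard_eq_tsum {ω : Ω} {t : ℝ≥0} (h : {i | T i ω ≤ t}.Finite) :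
    (({i | T i ω ≤ t}.ncard : ℕ) : ℝ≥0∞) = ∑' i, {ω | T i ω ≤ t}.indicator 1 ω := by
  rw [tsum_indicator_eq_encard, ← h.cast_ncard_eq]
  rfl

lemma finite_iff_tsum_ne_top {ω : Ω} {t : ℝ≥0} :
    {i | T i ω ≤ t}.Finite ↔ ∑' i, {ω | T i ω ≤ t}.indicator (1 : Ω → ℝ≥0∞) ω ≠ ∞ := by
  rw [tsum_indicator_eq_encard, ← Set.encard_ne_top_iff]
  simp

lemma finite_of_forall_nat {ω : Ω} (h : ∀ n : ℕ, {i | T i ω ≤ n}.Finite) (t : ℝ≥0) :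
    {i | T i ω ≤ t}.Finite := by
  obtain ⟨n, hn⟩ := exists_nat_ge t
  exact (h n).subset fun i hi => le_trans hi hn

lemma measurable_tsum_indicator {Ω ι : Type*} [MeasurableSpace Ω] [Countable ι] {A : ι → Set Ω}
    (hA : ∀ i, MeasurableSet (A i)) :
    Measurable fun ω => ∑' i, (A i).indicator (1 : Ω → ℝ≥0∞) ω :=
  Measurable.tsum fun i => measurable_one.indicator (hA i)

lemma measurableSet_goodSet [Countable ι] (hT : ∀ i, Measurable (T i)) :
    MeasurableSet (goodSet T) := by
  have h : goodSet T = (⋂ i, {ω | 0 < T i ω}) ∩ ((⋂ i, ⋂ j, ⋂ _ : i ≠ j, {ω | T i ω ≠ T j ω}) ∩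
      ⋂ n : ℕ, {ω | ∑' i, {ω | T i ω ≤ n}.indicator (1 : Ω → ℝ≥0∞) ω ≠ ∞}) := by
    ext ω
    simp only [goodSet, Set.mem_ofPred_eq, Set.mem_inter_iff, Set.mem_iInter,
      ← finite_iff_tsum_ne_top]
    refine and_congr_right fun _ => and_congr ?_ ⟨fun h n => h n, finite_of_forall_nat⟩
    exact ⟨fun h i j hij => h.ne hij, fun h i j hij => by by_contra hc; exact h i j hc hij⟩
  rw [h]
  refine (MeasurableSet.iInter fun i => measurableSet_lt measurable_const (hT i)).inter
    ((MeasurableSet.iInter fun i => MeasurableSet.iInter fun j => MeasurableSet.iInter fun _ =>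
      (measurableSet_eq_fun (hT i) (hT j)).compl).inter (MeasurableSet.iInter fun n => ?_))
  exact (measurableSet_eq_fun (measurable_tsum_indicator fun i =>
    measurableSet_le (hT i) measurable_const) measurable_const).compl

variable {𝓗 : ι → MeasurableSpace Ω}

/-- The largest history in which, as long as the time `T i` has not occurred, nothing is known but
events of the σ-algebra `𝓗 i` (up to sample points off `goodSet T`). -/
def jumpFiltration (mΩ : MeasurableSpace Ω) (T : ι → Ω → ℝ≥0) (𝓗 : ι → MeasurableSpace Ω) :
    Filtration ℝ≥0 mΩ where
  seq s :=
    { MeasurableSet' := fun A => MeasurableSet[mΩ] A ∧ ∀ i, ∃ A', MeasurableSet[𝓗 i] A' ∧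
        ∀ ω ∈ goodSet T, s < T i ω → (ω ∈ A' ↔ ω ∈ A)
      measurableSet_empty := ⟨MeasurableSet.empty, fun i => ⟨∅, @MeasurableSet.empty _ (𝓗 i), by simp⟩⟩
      measurableSet_compl := by
        rintro A ⟨hA, h⟩
        refine ⟨hA.compl, fun i => ?_⟩
        obtain ⟨A', hA', h'⟩ := h i
        exact ⟨A'ᶜ, hA'.compl, fun ω hω hs => not_congr (h' ω hω hs)⟩
      measurableSet_iUnion := by
        intro A hA
        refine ⟨MeasurableSet.iUnion fun n => (hA n).1, fun i => ?_⟩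
        choose A' hA' h' using fun n => (hA n).2 i
        refine ⟨⋃ n, A' n, MeasurableSet.iUnion hA', fun ω hω hs => ?_⟩
        simp only [Set.mem_iUnion]
        exact exists_congr fun n => h' n ω hω hs }
  mono' := by
    rintro s t hst A ⟨hA, h⟩
    refine ⟨hA, fun i => ?_⟩
    obtain ⟨A', hA', h'⟩ := h i
    exact ⟨A', hA', fun ω hω hs => h' ω hω (hst.trans_lt hs)⟩
  le' := fun _ _ hA => hA.1

lemma measurableSet_jumpFiltration {s : ℝ≥0} {A : Set Ω} :
    MeasurableSet[jumpFiltration mΩ T 𝓗 s] A ↔ MeasurableSet A ∧ ∀ i, ∃ A', MeasurableSet[𝓗 i] A' ∧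
      ∀ ω ∈ goodSet T, s < T i ω → (ω ∈ A' ↔ ω ∈ A) := Iff.rfl

/-- Up to the time `T i`, a predictable process is a function of the time and of the information
in `𝓗 i`. -/
lemma exists_eq_of_predictable {C : ℝ≥0 × Ω → ℝ≥0∞}
    (hC : Measurable[(jumpFiltration mΩ T 𝓗).predictable] C) (i : ι) :
    ∃ c : ℝ≥0 × Ω → ℝ≥0∞, Measurable[MeasurableSpace.prod inferInstance (𝓗 i)] c ∧
      ∀ t, ∀ ω ∈ goodSet T, t ≤ T i ω → C (t, ω) = c (t, ω) := by
  let mp : MeasurableSpace (ℝ≥0 × Ω) := MeasurableSpace.prod inferInstance (𝓗 i)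
  let D : Set (ℝ≥0 × Ω) := {p | p.2 ∈ goodSet T ∧ p.1 ≤ T i p.2}
  have hle : (jumpFiltration mΩ T 𝓗).predictable
      ≤ (mp.comap (Subtype.val : D → ℝ≥0 × Ω)).map Subtype.val := by
    refine measurableSpace_le_predictable_of_measurableSet (fun A hA => ?_) fun s A hA => ?_
    · obtain ⟨A', hA', h⟩ := (measurableSet_jumpFiltration.1 hA).2 i
      refine ⟨{⊥} ×ˢ A', @MeasurableSet.prod _ _ _ (𝓗 i) _ _ (measurableSet_singleton _) hA', ?_⟩
      ext ⟨⟨t, ω⟩, hp⟩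
      simp only [Set.mem_preimage, Set.mem_prod, Set.mem_singleton_iff, bot_eq_zero']
      exact and_congr_right fun _ => h ω hp.1 (hp.1.1 i)
    · obtain ⟨A', hA', h⟩ := (measurableSet_jumpFiltration.1 hA).2 i
      refine ⟨Set.Ioi s ×ˢ A', @MeasurableSet.prod _ _ _ (𝓗 i) _ _ measurableSet_Ioi hA', ?_⟩
      ext ⟨⟨t, ω⟩, hp⟩
      simp only [Set.mem_preimage, Set.mem_prod, Set.mem_Ioi]
      exact and_congr_right fun ht => h ω hp.1 (lt_of_lt_of_le ht hp.2)
  have hC' : Measurable[mp.comap (Subtype.val : D → ℝ≥0 × Ω)] (C ∘ (Subtype.val : D → ℝ≥0 × Ω)) :=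
    fun S hS => hle _ (hC hS)
  obtain ⟨c, hc, hcC⟩ := hC'.exists_eq_measurable_comp
  exact ⟨c, hc, fun t ω hω ht => congrFun hcC ⟨(t, ω), hω, ht⟩⟩

/-- The `i`-th time is a stopping time of the jump history as soon as, before any other time
`T k`, its occurrence is an event of `𝓗 k`. -/
lemma measurableSet_le_jumpFiltration (hT : ∀ i, Measurable (T i))
    (hocc : ∀ i k, i ≠ k → ∀ s, ∃ A', MeasurableSet[𝓗 k] A' ∧
      ∀ ω ∈ goodSet T, s < T k ω → (ω ∈ A' ↔ T i ω ≤ s)) (i : ι) (s : ℝ≥0) :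
    MeasurableSet[jumpFiltration mΩ T 𝓗 s] {ω | T i ω ≤ s} := by
  refine measurableSet_jumpFiltration.2 ⟨measurableSet_le (hT i) measurable_const, fun k => ?_⟩
  by_cases hik : i = k
  · subst hik
    exact ⟨∅, @MeasurableSet.empty _ (𝓗 i), fun ω _ hs => by simpa using hs⟩
  · exact hocc i k hik s

lemma adapted_jumpCount [Countable ι] (hT : ∀ i, Measurable (T i))
    (hocc : ∀ i k, i ≠ k → ∀ s, ∃ A', MeasurableSet[𝓗 k] A' ∧
      ∀ ω ∈ goodSet T, s < T k ω → (ω ∈ A' ↔ T i ω ≤ s)) :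
    Adapted (jumpFiltration mΩ T 𝓗) (jumpCount T) := by
  intro s
  have hgood : MeasurableSet[jumpFiltration mΩ T 𝓗 s] (goodSet T) :=
    measurableSet_jumpFiltration.2 ⟨measurableSet_goodSet hT, fun i =>
      ⟨Set.univ, MeasurableSet.univ, fun ω hω _ => by simpa using hω⟩⟩
  have hcast : Measurable[jumpFiltration mΩ T 𝓗 s] fun ω => (jumpCount T s ω : ℝ≥0∞) := by
    have h : (fun ω => (jumpCount T s ω : ℝ≥0∞))
        = fun ω => ∑' i, (goodSet T ∩ {ω | T i ω ≤ s}).indicator 1 ω := by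
      ext ω
      by_cases hω : ω ∈ goodSet T
      · rw [jumpCount_of_mem hω, coe_ncard_eq_tsum (hω.2.2 s)]
        refine tsum_congr fun i => ?_
        simp [Set.indicator, hω]
      · simp [jumpCount_of_notMem hω, Set.indicator, hω]
    rw [h]
    exact @measurable_tsum_indicator _ _ (jumpFiltration mΩ T 𝓗 s) _ _ fun i =>
      hgood.inter (measurableSet_le_jumpFiltration hT hocc i s)
  refine @measurable_to_countable' _ _ _ _ (jumpFiltration mΩ T 𝓗 s) _ fun n => ?_
  have : jumpCount T s ⁻¹' {n} = (fun ω => (jumpCount T s ω : ℝ≥0∞)) ⁻¹' {(n : ℝ≥0∞)} := by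
    ext ω; simp
  rw [this]
  exact hcast (measurableSet_singleton _)

/-- The counting process of the times `T i` admits the intensity `∑ i, ρ i` if each `T i` has the
stochastic hazard rate `ρ i` given `𝓗 i`. -/
theorem admitsIntensity_jumpCount [Countable ι] {P : Measure Ω} [IsProbabilityMeasure P]
    (h𝓗 : ∀ i, 𝓗 i ≤ mΩ) (hT : ∀ i, Measurable (T i)) (hgood : ∀ᵐ ω ∂P, ω ∈ goodSet T)
    (hocc : ∀ i k, i ≠ k → ∀ s, ∃ A', MeasurableSet[𝓗 k] A' ∧
      ∀ ω ∈ goodSet T, s < T k ω → (ω ∈ A' ↔ T i ω ≤ s))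
    {ρ : ι → ℝ≥0 → Ω → ℝ≥0∞} (hρ : ∀ i, Measurable fun p : ℝ≥0 × Ω => ρ i p.1 p.2)
    (hρ0 : ∀ i t ω, T i ω < t → ρ i t ω = 0)
    (hhaz : ∀ i, ∀ c : ℝ≥0 × Ω → ℝ≥0∞, Measurable[MeasurableSpace.prod inferInstance (𝓗 i)] c →
      ∫⁻ ω, c (T i ω, ω) ∂P = ∫⁻ ω, ∫⁻ t, c (t, ω) * ρ i t ω ∂timeMeasure ∂P)
    {rate : ℝ≥0 → Ω → ℝ≥0}
    (hrate : ∀ᵐ ω ∂P, ∀ᵐ t ∂timeMeasure, ∑' i, ρ i t ω = (rate t ω : ℝ≥0∞))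
    (hprog : IsProgressive (jumpFiltration mΩ T 𝓗) rate)
    (hint : ∀ t : ℝ≥0, ∀ᵐ ω ∂P, ∫⁻ s in Set.Iic t, (rate s ω : ℝ≥0∞) ∂timeMeasure < ∞) :
    AdmitsIntensity P (jumpFiltration mΩ T 𝓗) (jumpCount T) rate where
  countingPath := isCountingPath_jumpCount T
  adapted := adapted_jumpCount hT hocc
  progressive := hprog
  locallyIntegrable := hint
  intensity := by
    intro C hC
    have hCm : Measurable fun p : ℝ≥0 × Ω => C p.1 p.2 := hC.mono (predictable_le_prod _) le_rfl
    choose c hc hcC using exists_eq_of_predictable hC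
    have hcm : ∀ i, Measurable (c i) := fun i =>
      (hc i).mono (sup_le_sup_left (MeasurableSpace.comap_mono (h𝓗 i)) _) le_rfl
    calc ∫⁻ ω, countIntegral (fun t => C t ω) (fun t => jumpCount T t ω) ∂P
        = ∫⁻ ω, ∑' i, c i (T i ω, ω) ∂P := by
          refine lintegral_congr_ae ?_
          filter_upwards [hgood] with ω hω
          rw [countIntegral_jumpCount hω]
          exact tsum_congr fun i => hcC i _ ω hω le_rfl
      _ = ∑' i, ∫⁻ ω, c i (T i ω, ω) ∂P :=
          lintegral_tsum fun i => ((hcm i).comp ((hT i).prodMk measurable_id)).aemeasurable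
      _ = ∑' i, ∫⁻ ω, ∫⁻ t, C t ω * ρ i t ω ∂timeMeasure ∂P := by
          refine tsum_congr fun i => (hhaz i _ (hc i)).trans (lintegral_congr_ae ?_)
          filter_upwards [hgood] with ω hω
          refine lintegral_congr fun t => ?_
          rcases le_or_gt t (T i ω) with ht | ht
          · rw [hcC i t ω hω ht]
          · simp [hρ0 i t ω ht]
      _ = ∫⁻ ω, ∑' i, ∫⁻ t, C t ω * ρ i t ω ∂timeMeasure ∂P := by
          refine (lintegral_tsum fun i => ?_).symm
          exact (Measurable.lintegral_prod_right' (f := fun p : Ω × ℝ≥0 => C p.2 p.1 * ρ i p.2 p.1)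
            ((hCm.mul (hρ i)).comp measurable_swap)).aemeasurable
      _ = ∫⁻ ω, ∫⁻ t, C t ω * (rate t ω : ℝ≥0∞) ∂timeMeasure ∂P := by
          refine lintegral_congr_ae ?_
          filter_upwards [hrate] with ω hω
          have hm : ∀ i, AEMeasurable (fun t => C t ω * ρ i t ω) timeMeasure := fun i =>
            ((hCm.mul (hρ i)).comp measurable_prodMk_right).aemeasurable
          rw [← lintegral_tsum hm]
          refine lintegral_congr_ae ?_
          filter_upwards [hω] with t ht
          rw [ENNReal.tsum_mul_left, ht]

end JumpTimes

/-! ### Hazard rates -/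

lemma lintegral_indicator_Ici_timeMeasure (r : ℝ≥0) (f : ℝ≥0 → ℝ≥0∞) :
    ∫⁻ t, (Set.Ici r).indicator f t ∂timeMeasure = ∫⁻ x, f (r + x) ∂timeMeasure := by
  have h1 := lintegral_timeMeasure fun x => f (r + x.toNNReal)
  have h2 := lintegral_timeMeasure fun x => (Set.Ici r).indicator f x.toNNReal
  simp only [Real.toNNReal_coe] at h1 h2
  rw [h1, h2, ← lintegral_indicator measurableSet_Ici, ← lintegral_indicator measurableSet_Ici,
    ← lintegral_add_left_eq_self _ (r : ℝ)]
  refine lintegral_congr fun x => ?_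
  by_cases hx : 0 ≤ x
  · have h3 : (r : ℝ) + x ∈ Set.Ici (0 : ℝ) := add_nonneg r.2 hx
    have h4 : ((r : ℝ) + x).toNNReal = r + x.toNNReal := by
      rw [Real.toNNReal_add r.coe_nonneg hx, Real.toNNReal_coe]
    rw [Set.indicator_of_mem h3, Set.indicator_of_mem (show x ∈ Set.Ici 0 from hx), h4,
      Set.indicator_of_mem (by simp)]
  · rw [Set.indicator_of_notMem (s := Set.Ici (0 : ℝ)) (a := x) (by simpa using hx)]
    by_cases h3 : (r : ℝ) + x ∈ Set.Ici (0 : ℝ)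
    · rw [Set.indicator_of_mem h3, Set.indicator_of_notMem]
      simp only [Set.mem_Ici, not_le]
      rw [Real.toNNReal_lt_iff_lt_coe h3]
      linarith
    · exact Set.indicator_of_notMem h3 _

/-- `h` is the hazard rate of the law `μ` of a random time: its density at `x` is
`h x * μ [x, ∞)`. -/
def HasHazardRate (μ : Measure ℝ≥0) (h : ℝ≥0 → ℝ≥0) : Prop :=
  μ = timeMeasure.withDensity fun x => (h x : ℝ≥0∞) * μ (Set.Ici x)

section Hazard

variable {Ω : Type*} {mΩ : MeasurableSpace Ω} {P : Measure Ω} [IsProbabilityMeasure P]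

lemma lintegral_comp_of_indepFun {α : Type*} {mα : MeasurableSpace α} {Z : Ω → α} {τ : Ω → ℝ≥0}
    (hZ : Measurable Z) (hτ : Measurable τ) (hind : ProbabilityTheory.IndepFun Z τ P)
    {f : α × ℝ≥0 → ℝ≥0∞} (hf : Measurable f) :
    ∫⁻ ω, f (Z ω, τ ω) ∂P = ∫⁻ ω, ∫⁻ x, f (Z ω, x) ∂(P.map τ) ∂P := by
  have h1 := (ProbabilityTheory.indepFun_iff_map_prod_eq_prod_map_map
    hZ.aemeasurable hτ.aemeasurable).1 hind
  have : IsProbabilityMeasure (P.map τ) := Measure.isProbabilityMeasure_map hτ.aemeasurable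
  rw [← lintegral_map (f := f) (g := fun ω => (Z ω, τ ω)) hf (hZ.prodMk hτ), h1,
    lintegral_prod _ hf.aemeasurable,
    lintegral_map (f := fun z => ∫⁻ x, f (z, x) ∂(P.map τ)) hf.lintegral_prod_right' hZ]

/-- The time `R + τ`, where `τ` has hazard rate `h` and is independent of the past, has the
stochastic hazard rate `h (t - R)` on `(R, R + τ]`. -/
lemma lintegral_hazard {α : Type*} {mα : MeasurableSpace α} {Z : Ω → α} {τ : Ω → ℝ≥0}
    (hZ : Measurable Z) (hτ : Measurable τ) (hind : ProbabilityTheory.IndepFun Z τ P)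
    {h : ℝ≥0 → ℝ≥0} (hh : Measurable h) (hhaz : HasHazardRate (P.map τ) h)
    {R : α → ℝ≥0} (hR : Measurable R) {c : ℝ≥0 × α → ℝ≥0∞} (hc : Measurable c) :
    ∫⁻ ω, c (R (Z ω) + τ ω, Z ω) ∂P
      = ∫⁻ ω, ∫⁻ t, c (t, Z ω) * (Set.Ioc (R (Z ω)) (R (Z ω) + τ ω)).indicator
          (fun t => (h (t - R (Z ω)) : ℝ≥0∞)) t ∂timeMeasure ∂P := by
  set μ := P.map τ with hμ
  have hμp : IsProbabilityMeasure μ := Measure.isProbabilityMeasure_map hτ.aemeasurable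
  have hh' : Measurable fun x => (h x : ℝ≥0∞) := hh.coe_nnreal_ennreal
  have htail : Measurable fun x => μ (Set.Ici x) :=
    Antitone.measurable fun x y hxy => measure_mono (Set.Ici_subset_Ici.2 hxy)
  have hshift : ∀ (r y : ℝ≥0) (f : ℝ≥0 → ℝ≥0∞),
      ∫⁻ t, f t * (Set.Ioc r (r + y)).indicator (fun t => (h (t - r) : ℝ≥0∞)) t ∂timeMeasure
        = ∫⁻ x, f (r + x) * (Set.Iic y).indicator (fun x => (h x : ℝ≥0∞)) x ∂timeMeasure := by
    intro r y f
    have := lintegral_indicator_Ici_timeMeasure r fun t =>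
      f t * (Set.Iic y).indicator (fun x => (h x : ℝ≥0∞)) (t - r)
    simp only [add_tsub_cancel_left] at this
    rw [← this]
    have hne : ∀ᵐ t ∂timeMeasure, t ≠ r := by
      rw [ae_iff]; simp
    refine lintegral_congr_ae ?_
    filter_upwards [hne] with t htr
    rcases lt_trichotomy r t with ht | ht | ht
    · have : t ≤ r + y ↔ t - r ≤ y := by rw [tsub_le_iff_left]
      simp [Set.indicator, ht, ht.le, this]
    · exact absurd ht.symm htr
    · simp [Set.indicator, ht.not_ge, ht.not_gt]
  have hL : ∫⁻ ω, c (R (Z ω) + τ ω, Z ω) ∂P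
      = ∫⁻ ω, ∫⁻ x, c (R (Z ω) + x, Z ω) ∂μ ∂P :=
    lintegral_comp_of_indepFun hZ hτ hind (f := fun p => c (R p.1 + p.2, p.1)) (by fun_prop)
  have hset : MeasurableSet {q : (α × ℝ≥0) × ℝ≥0 | q.2 ≤ q.1.2} :=
    measurableSet_le measurable_snd measurable_fst.snd
  have hF : Measurable fun q : (α × ℝ≥0) × ℝ≥0 =>
      c (R q.1.1 + q.2, q.1.1) * (Set.Iic q.1.2).indicator (fun x => (h x : ℝ≥0∞)) q.2 := by
    have h1 : Measurable fun q : (α × ℝ≥0) × ℝ≥0 => c (R q.1.1 + q.2, q.1.1) := by fun_prop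
    exact h1.mul ((hh'.comp measurable_snd).indicator hset)
  simp only [hshift]
  rw [hL, lintegral_comp_of_indepFun hZ hτ hind (f := fun p => ∫⁻ x, c (R p.1 + x, p.1) *
    (Set.Iic p.2).indicator (fun x => (h x : ℝ≥0∞)) x ∂timeMeasure) hF.lintegral_prod_right']
  refine lintegral_congr fun ω => ?_
  have hcm : Measurable fun x => c (R (Z ω) + x, Z ω) := by fun_prop
  have hF' : Measurable fun p : ℝ≥0 × ℝ≥0 =>
      c (R (Z ω) + p.2, Z ω) * (Set.Iic p.1).indicator (fun x => (h x : ℝ≥0∞)) p.2 :=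
    hF.comp (((measurable_const (a := Z ω)).prodMk measurable_fst).prodMk measurable_snd)
  rw [lintegral_lintegral_swap hF'.aemeasurable]
  conv_lhs => rw [hhaz]
  rw [lintegral_withDensity_eq_lintegral_mul _ (f := fun x => (h x : ℝ≥0∞) * μ (Set.Ici x))
    (hh'.mul htail) hcm]
  refine lintegral_congr fun x => ?_
  have h2 : ∀ y, c (R (Z ω) + x, Z ω) * (Set.Iic y).indicator (fun x => (h x : ℝ≥0∞)) x
      = (Set.Ici x).indicator (fun _ => c (R (Z ω) + x, Z ω) * h x) y := by
    intro y
    by_cases hxy : x ≤ y <;> simp [Set.indicator, hxy]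
  simp only [h2, Pi.mul_apply, ← hμ]
  rw [lintegral_indicator measurableSet_Ici, setLIntegral_const]
  ring

end Hazard

/-! ### Exponential and uniform laws on the half-line -/

/-- The exponential law of rate `r` on `[0, ∞)`. -/
noncomputable def expLaw (r : ℝ≥0) : Measure ℝ≥0 :=
  timeMeasure.withDensity fun x => ENNReal.ofReal (r * Real.exp (-(r * x)))

lemma isProbabilityMeasure_expLaw {r : ℝ≥0} (hr : 0 < r) : IsProbabilityMeasure (expLaw r) := by
  constructor
  rw [expLaw, withDensity_apply _ MeasurableSet.univ, Measure.restrict_univ,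
    lintegral_timeMeasure fun x => ENNReal.ofReal (r * Real.exp (-(r * x))),
    ← ProbabilityTheory.lintegral_exponentialPDF_eq_one (NNReal.coe_pos.2 hr),
    ← lintegral_indicator measurableSet_Ici]
  refine lintegral_congr fun x => ?_
  rw [ProbabilityTheory.exponentialPDF_eq]
  by_cases hx : 0 ≤ x <;> simp [Set.indicator, hx]

lemma expLaw_Ici {r : ℝ≥0} (hr : 0 < r) (x : ℝ≥0) :
    expLaw r (Set.Ici x) = ENNReal.ofReal (Real.exp (-(r * x))) := by
  have h1 := (isProbabilityMeasure_expLaw hr).measure_univ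
  rw [expLaw, withDensity_apply _ MeasurableSet.univ, Measure.restrict_univ] at h1
  rw [expLaw, withDensity_apply _ measurableSet_Ici, ← lintegral_indicator measurableSet_Ici,
    lintegral_indicator_Ici_timeMeasure]
  have h2 : ∀ y : ℝ≥0, ENNReal.ofReal (r * Real.exp (-(r * (x + y : ℝ≥0))))
      = ENNReal.ofReal (Real.exp (-(r * x))) * ENNReal.ofReal (r * Real.exp (-(r * y))) := by
    intro y
    rw [← ENNReal.ofReal_mul (Real.exp_nonneg _), NNReal.coe_add, mul_add, neg_add, Real.exp_add]
    ring_nf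
  simp only [h2]
  rw [lintegral_const_mul _ (by fun_prop), h1, mul_one]

lemma hasHazardRate_expLaw {r : ℝ≥0} (hr : 0 < r) : HasHazardRate (expLaw r) fun _ => r := by
  rw [HasHazardRate]
  simp only [expLaw_Ici hr]
  rw [expLaw]
  congr 1
  ext x
  rw [ENNReal.ofReal_mul r.coe_nonneg, ENNReal.ofReal_coe_nnreal]

/-- The uniform law on `[a, a + δ)`. -/
noncomputable def unifLaw (a δ : ℝ≥0) : Measure ℝ≥0 :=
  timeMeasure.withDensity ((Set.Ico a (a + δ)).indicator fun _ => (δ : ℝ≥0∞)⁻¹)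

lemma unifLaw_apply (a δ : ℝ≥0) {s : Set ℝ≥0} (hs : MeasurableSet s) :
    unifLaw a δ s = (δ : ℝ≥0∞)⁻¹ * timeMeasure (Set.Ico a (a + δ) ∩ s) := by
  rw [unifLaw, withDensity_apply _ hs, lintegral_indicator measurableSet_Ico, setLIntegral_const,
    Measure.restrict_apply measurableSet_Ico]

lemma unifLaw_of_Ico_subset {a δ : ℝ≥0} (hδ : 0 < δ) {s : Set ℝ≥0} (hs : MeasurableSet s)
    (h : Set.Ico a (a + δ) ⊆ s) : unifLaw a δ s = 1 := by
  rw [unifLaw_apply a δ hs, Set.inter_eq_left.2 h, timeMeasure_Ico, add_tsub_cancel_left]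
  exact ENNReal.inv_mul_cancel (by exact_mod_cast hδ.ne') ENNReal.coe_ne_top

lemma isProbabilityMeasure_unifLaw {a δ : ℝ≥0} (hδ : 0 < δ) :
    IsProbabilityMeasure (unifLaw a δ) :=
  ⟨unifLaw_of_Ico_subset hδ MeasurableSet.univ (Set.subset_univ _)⟩

/-- The hazard rate of the uniform law on `[a, a + δ)`. -/
noncomputable def unifHazard (a δ t : ℝ≥0) : ℝ≥0 :=
  (Set.Ico a (a + δ)).indicator (fun t => (a + δ - t)⁻¹) t

lemma measurable_unifHazard (a δ : ℝ≥0) : Measurable (unifHazard a δ) :=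
  Measurable.indicator (by fun_prop) measurableSet_Ico

lemma hasHazardRate_unifLaw (a δ : ℝ≥0) :
    HasHazardRate (unifLaw a δ) (unifHazard a δ) := by
  rw [HasHazardRate]
  conv_lhs => rw [unifLaw]
  congr 1
  ext x
  by_cases hx : x ∈ Set.Ico a (a + δ)
  · have h1 : Set.Ico a (a + δ) ∩ Set.Ici x = Set.Ico x (a + δ) := by
      ext y
      simp only [Set.mem_inter_iff, Set.mem_Ico, Set.mem_Ici]
      exact ⟨fun h => ⟨h.2, h.1.2⟩, fun h => ⟨⟨hx.1.trans h.1, h.2⟩, h.1⟩⟩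
    have h2 : a + δ - x ≠ 0 := (tsub_pos_of_lt hx.2).ne'
    rw [unifLaw_apply a δ measurableSet_Ici, h1, timeMeasure_Ico, unifHazard,
      Set.indicator_of_mem hx, Set.indicator_of_mem hx, ENNReal.coe_inv h2, mul_left_comm,
      ENNReal.inv_mul_cancel (by exact_mod_cast h2) ENNReal.coe_ne_top, mul_one]
  · simp [unifHazard, hx]

/-! ### One signal photon superposed on the dark current -/

section SignalAndDark

variable {Ω : Type*} (U : Option ℕ → Ω → ℝ≥0) (dark : ℝ≥0)

/-- The `n`-th dark count occurs at time `darkStart U (n + 1)`: the gaps between the dark counts are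
the coordinates `U (some k)`. -/
def darkStart (n : ℕ) (ω : Ω) : ℝ≥0 := ∑ k ∈ Finset.range n, U (some k) ω

/-- The indices of the counts: the signal photon, and the dark counts, which are absent if there is
no dark current. -/
abbrev CountIndex : Type := Unit ⊕ {_n : ℕ // dark ≠ 0}

/-- The coordinate that triggers a count. -/
def countCoord : CountIndex dark → Option ℕ := Sum.elim (fun _ => none) fun n => some n.1

/-- The time from which a count is awaited. -/
def countStart : CountIndex dark → Ω → ℝ≥0 := Sum.elim (fun _ _ => 0) fun n => darkStart U n.1

/-- The time of a count. -/
def countTime (i : CountIndex dark) (ω : Ω) : ℝ≥0 :=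
  countStart U dark i ω + U (countCoord dark i) ω

/-- The information carried by all the coordinates but the `j`-th. -/
@[reducible]
def otherCoords (j : Option ℕ) : MeasurableSpace Ω :=
  ⨆ k ∈ ({j}ᶜ : Set (Option ℕ)), MeasurableSpace.comap (U k) inferInstance

variable {U dark}

lemma darkStart_succ (n : ℕ) (ω : Ω) :
    darkStart U (n + 1) ω = darkStart U n ω + U (some n) ω := Finset.sum_range_succ _ _

lemma monotone_darkStart (ω : Ω) : Monotone fun n => darkStart U n ω :=
  monotone_nat_of_le_succ fun n => by rw [darkStart_succ]; exact le_self_add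

lemma countTime_inl (u : Unit) (ω : Ω) : countTime U dark (Sum.inl u) ω = U none ω := by
  simp [countTime, countStart, countCoord]

lemma countTime_inr (n : {_n : ℕ // dark ≠ 0}) (ω : Ω) :
    countTime U dark (Sum.inr n) ω = darkStart U (n.1 + 1) ω := by
  simp [countTime, countStart, countCoord, darkStart_succ]

lemma measurable_otherCoords {j k : Option ℕ} (h : k ≠ j) : Measurable[otherCoords U j] (U k) :=
  Measurable.of_comap_le (le_iSup₂_of_le (f := fun k _ => MeasurableSpace.comap (U k) inferInstance)
    k h le_rfl)

lemma measurable_darkStart_otherCoords {j : Option ℕ} {n : ℕ} (h : ∀ k < n, some k ≠ j) :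
    Measurable[otherCoords U j] (darkStart U n) := by
  refine @Finset.measurable_fun_sum _ _ _ _ _ _ (otherCoords U j) _ _ fun k hk => ?_
  exact measurable_otherCoords (h k (Finset.mem_range.1 hk))

lemma measurable_countStart_otherCoords (i : CountIndex dark) :
    Measurable[otherCoords U (countCoord dark i)] (countStart U dark i) := by
  rcases i with _ | n
  · exact @measurable_const _ _ _ (otherCoords U _) 0
  · exact measurable_darkStart_otherCoords fun k hk h =>
      hk.ne (Option.some_injective _ h)

/-- Before a count, the occurrence of another one does not depend on the coordinate that triggers
the former. -/
lemma exists_otherCoords_countTime_le {i k : CountIndex dark} (hik : i ≠ k) (s : ℝ≥0) :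
    ∃ A', MeasurableSet[otherCoords U (countCoord dark k)] A' ∧
      ∀ ω ∈ goodSet (countTime U dark), s < countTime U dark k ω →
        (ω ∈ A' ↔ countTime U dark i ω ≤ s) := by
  have hset : ∀ {f : Ω → ℝ≥0} (j : Option ℕ), Measurable[otherCoords U j] f →
      MeasurableSet[otherCoords U j] {ω | f ω ≤ s} := fun j hf => hf measurableSet_Iic
  rcases i with _ | n <;> rcases k with _ | m
  · exact absurd rfl hik
  · refine ⟨{ω | U none ω ≤ s}, hset _ (measurable_otherCoords (by simp [countCoord])), ?_⟩
    intro ω _ _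
    rw [countTime_inl]
    rfl
  · refine ⟨{ω | darkStart U (n.1 + 1) ω ≤ s},
      hset _ (measurable_darkStart_otherCoords (by simp [countCoord])), ?_⟩
    intro ω _ _
    rw [countTime_inr]
    rfl
  · have hnm : n.1 ≠ m.1 := fun h => hik (by rw [Subtype.ext h])
    rcases lt_or_gt_of_ne hnm with h | h
    · refine ⟨{ω | darkStart U (n.1 + 1) ω ≤ s}, hset _ (measurable_darkStart_otherCoords ?_), ?_⟩
      · intro k hk hk'
        have : k = m.1 := Option.some_injective _ hk'
        omega
      · intro ω _ _
        rw [countTime_inr]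
        rfl
    · refine ⟨∅, @MeasurableSet.empty _ (otherCoords U _), fun ω _ hs => ?_⟩
      rw [countTime_inr] at hs ⊢
      have := monotone_darkStart (U := U) ω (show m.1 + 1 ≤ n.1 + 1 by omega)
      simpa using hs.trans_le this

variable (U) in
/-- The input for the pulse on `[a, a + δ)`: the hazard rate of the uniform law up to the arrival
of the signal photon, and nothing afterwards. -/
noncomputable def pulse (a δ t : ℝ≥0) (ω : Ω) : ℝ≥0 :=
  (Set.Ioc 0 (U none ω)).indicator (unifHazard a δ) t

/-- The indicators of the successive waiting periods of the dark counts sum up to at most one. -/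
lemma tsum_indicator_Ioc_darkStart_le (r : ℝ≥0∞) (ω : Ω) (t : ℝ≥0) :
    ∑' n, (Set.Ioc (darkStart U n ω) (darkStart U (n + 1) ω)).indicator (fun _ => r) t ≤ r := by
  by_cases h : ∃ n, t ∈ Set.Ioc (darkStart U n ω) (darkStart U (n + 1) ω)
  · obtain ⟨n, hn⟩ := h
    rw [tsum_eq_single n, Set.indicator_of_mem hn]
    intro k hk
    refine Set.indicator_of_notMem (fun hk' => ?_) _
    exact Set.disjoint_left.1 ((monotone_darkStart (U := U) ω).pairwise_disjoint_on_Ioc_succ hk) hk' hn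
  · push Not at h
    simp [h]

lemma tsum_indicator_Ioc_darkStart (r : ℝ≥0∞) {ω : Ω} {t : ℝ≥0} (ht : 0 < t)
    (hω : {n : ℕ | darkStart U (n + 1) ω ≤ t}.Finite) :
    ∑' n, (Set.Ioc (darkStart U n ω) (darkStart U (n + 1) ω)).indicator (fun _ => r) t = r := by
  refine le_antisymm (tsum_indicator_Ioc_darkStart_le r ω t) ?_
  have hex : ∃ n, t ≤ darkStart U (n + 1) ω := by
    obtain ⟨n, hn⟩ := hω.exists_notMem
    exact ⟨n, (not_le.1 hn).le⟩
  classical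
  have hlt : darkStart U (Nat.find hex) ω < t := by
    rcases hN : Nat.find hex with _ | k
    · simpa [darkStart] using ht
    · exact not_le.1 (Nat.find_min hex (m := k) (by omega))
  have hmem : t ∈ Set.Ioc (darkStart U (Nat.find hex) ω) (darkStart U (Nat.find hex + 1) ω) :=
    ⟨hlt, Nat.find_spec hex⟩
  have := ENNReal.le_tsum (f := fun n => (Set.Ioc (darkStart U n ω)
    (darkStart U (n + 1) ω)).indicator (fun _ => r) t) (Nat.find hex)
  rwa [Set.indicator_of_mem hmem] at this

variable {mΩ : MeasurableSpace Ω} {P : Measure Ω}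

lemma otherCoords_le (hU : ∀ j, Measurable (U j)) (j : Option ℕ) : otherCoords U j ≤ mΩ :=
  iSup₂_le fun _ _ => (hU _).comap_le

lemma measurable_darkStart (hU : ∀ j, Measurable (U j)) (n : ℕ) : Measurable (darkStart U n) :=
  Finset.measurable_fun_sum _ fun _ _ => hU _

lemma measurable_countStart (hU : ∀ j, Measurable (U j)) (i : CountIndex dark) :
    Measurable (countStart U dark i) :=
  (measurable_countStart_otherCoords i).mono (otherCoords_le hU _) le_rfl

lemma measurable_countTime (hU : ∀ j, Measurable (U j)) (i : CountIndex dark) :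
    Measurable (countTime U dark i) :=
  (measurable_countStart hU i).add (hU _)

lemma lintegral_coord_hazard [IsProbabilityMeasure P] (hU : ∀ j, Measurable (U j)) (hind : ProbabilityTheory.iIndepFun U P)
    (j : Option ℕ) {h : ℝ≥0 → ℝ≥0} (hh : Measurable h) (hhaz : HasHazardRate (P.map (U j)) h)
    {R : Ω → ℝ≥0} (hR : Measurable[otherCoords U j] R) {c : ℝ≥0 × Ω → ℝ≥0∞}
    (hc : Measurable[MeasurableSpace.prod inferInstance (otherCoords U j)] c) :
    ∫⁻ ω, c (R ω + U j ω, ω) ∂P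
      = ∫⁻ ω, ∫⁻ t, c (t, ω) * (Set.Ioc (R ω) (R ω + U j ω)).indicator
          (fun t => (h (t - R ω) : ℝ≥0∞)) t ∂timeMeasure ∂P := by
  have h1 : ProbabilityTheory.Indep (otherCoords U j)
      (MeasurableSpace.comap (U j) inferInstance) P := by
    have := ProbabilityTheory.indep_iSup_of_disjoint (fun k => (hU k).comap_le)
      ((ProbabilityTheory.iIndepFun_iff_iIndep _ _ _).1 hind)
      (disjoint_compl_left (a := ({j} : Set (Option ℕ))))
    simpa [otherCoords] using this
  have h2 : @ProbabilityTheory.IndepFun Ω Ω ℝ≥0 mΩ (otherCoords U j) _ id (U j) P := by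
    have h3 : ProbabilityTheory.Indep ((otherCoords U j).comap id)
        (MeasurableSpace.comap (U j) inferInstance) P := by rwa [MeasurableSpace.comap_id]
    exact h3
  exact @lintegral_hazard Ω mΩ P _ Ω (otherCoords U j) id (U j)
    (measurable_id'' (otherCoords_le hU j)) (hU j) h2 h hh hhaz R hR c hc

lemma ae_coord_pos (hU : ∀ j, Measurable (U j)) {j : Option ℕ} {h : ℝ≥0 → ℝ≥0}
    (hhaz : HasHazardRate (P.map (U j)) h) : ∀ᵐ ω ∂P, 0 < U j ω := by
  have h1 : P.map (U j) {0} = 0 := by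
    rw [hhaz]
    exact withDensity_absolutelyContinuous _ _ (timeMeasure_singleton 0)
  rw [Measure.map_apply (hU j) (measurableSet_singleton 0)] at h1
  rw [ae_iff]
  convert h1 using 2
  ext ω
  simp

/-- The expected number of dark counts on `[0, t]` is at most `r t`; in particular they do not
accumulate. -/
lemma ae_finite_darkStart_le [IsProbabilityMeasure P] (hU : ∀ j, Measurable (U j))
    (hind : ProbabilityTheory.iIndepFun U P)
    {r : ℝ≥0} (hr : ∀ n, HasHazardRate (P.map (U (some n))) fun _ => r) :
    ∀ᵐ ω ∂P, ∀ t : ℝ≥0, {n : ℕ | darkStart U (n + 1) ω ≤ t}.Finite := by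
  have hnat : ∀ᵐ ω ∂P, ∀ N : ℕ, {n : ℕ | darkStart U (n + 1) ω ≤ N}.Finite := by
    rw [ae_all_iff]
    intro N
    have hmeas : ∀ n, MeasurableSet {ω | darkStart U (n + 1) ω ≤ (N : ℝ≥0)} := fun n =>
      measurableSet_le (measurable_darkStart hU _) measurable_const
    have h1 : ∫⁻ ω, ∑' n, {ω | darkStart U (n + 1) ω ≤ N}.indicator (1 : Ω → ℝ≥0∞) ω ∂P
        ≤ r * timeMeasure (Set.Iic (N : ℝ≥0)) := by
      rw [lintegral_tsum fun n => (measurable_one.indicator (hmeas n)).aemeasurable]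
      have h2 : ∀ n, ∫⁻ ω, {ω | darkStart U (n + 1) ω ≤ N}.indicator (1 : Ω → ℝ≥0∞) ω ∂P
          = ∫⁻ ω, ∫⁻ t, (Set.Iic (N : ℝ≥0)).indicator 1 t *
            (Set.Ioc (darkStart U n ω) (darkStart U (n + 1) ω)).indicator
              (fun _ => (r : ℝ≥0∞)) t ∂timeMeasure ∂P := by
        intro n
        have hc : Measurable[MeasurableSpace.prod inferInstance (otherCoords U (some n))]
            fun p : ℝ≥0 × Ω => (Set.Iic (N : ℝ≥0)).indicator (1 : ℝ≥0 → ℝ≥0∞) p.1 := by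
          let := otherCoords U (some n)
          exact (measurable_one.indicator measurableSet_Iic).comp measurable_fst
        have h3 := lintegral_coord_hazard hU hind (some n) measurable_const (hr n)
          (measurable_darkStart_otherCoords fun k hk h => hk.ne (Option.some_injective _ h)) hc
        simp only [← darkStart_succ] at h3
        exact h3
      simp only [h2]
      have hm : ∀ n, Measurable fun p : Ω × ℝ≥0 => (Set.Iic (N : ℝ≥0)).indicator 1 p.2 *
          (Set.Ioc (darkStart U n p.1) (darkStart U (n + 1) p.1)).indicator
            (fun _ => (r : ℝ≥0∞)) p.2 := by
        intro n
        have hs : MeasurableSet {p : Ω × ℝ≥0 | p.2 ∈ Set.Ioc (darkStart U n p.1)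
            (darkStart U (n + 1) p.1)} :=
          (measurableSet_lt (f := fun p : Ω × ℝ≥0 => darkStart U n p.1)
            ((measurable_darkStart hU n).comp measurable_fst) measurable_snd).inter
          (measurableSet_le (g := fun p : Ω × ℝ≥0 => darkStart U (n + 1) p.1) measurable_snd
            ((measurable_darkStart hU (n + 1)).comp measurable_fst))
        exact ((measurable_one.indicator measurableSet_Iic).comp measurable_snd).mul
          ((measurable_const (a := (r : ℝ≥0∞))).indicator hs)
      rw [← lintegral_tsum fun n => (Measurable.lintegral_prod_right' (hm n)).aemeasurable]
      calc _ ≤ ∫⁻ _ω, r * timeMeasure (Set.Iic (N : ℝ≥0)) ∂P := by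
            refine lintegral_mono fun ω => ?_
            simp only
            have hm' : ∀ n, AEMeasurable (fun t => (Set.Iic (N : ℝ≥0)).indicator 1 t *
                (Set.Ioc (darkStart U n ω) (darkStart U (n + 1) ω)).indicator
                  (fun _ => (r : ℝ≥0∞)) t) timeMeasure := fun n =>
              ((hm n).comp (measurable_prodMk_left (x := ω))).aemeasurable
            rw [← lintegral_tsum hm',
              ← setLIntegral_const, ← lintegral_indicator measurableSet_Iic]
            refine lintegral_mono fun t => ?_
            simp only
            rw [ENNReal.tsum_mul_left]
            by_cases ht : t ∈ Set.Iic (N : ℝ≥0)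
            · rw [Set.indicator_of_mem ht, Set.indicator_of_mem ht, Pi.one_apply, one_mul]
              exact tsum_indicator_Ioc_darkStart_le _ ω t
            · simp [Set.indicator_of_notMem ht]
        _ = _ := by simp
    have hfin : timeMeasure (Set.Iic (N : ℝ≥0)) ≠ ∞ := by
      rw [timeMeasure_Iic]; exact ENNReal.coe_ne_top
    have h4 := ae_lt_top (measurable_tsum_indicator hmeas)
      (h1.trans_lt (ENNReal.mul_lt_top ENNReal.coe_lt_top hfin.lt_top)).ne
    filter_upwards [h4] with ω hω
    exact (finite_iff_tsum_ne_top (T := fun n => darkStart U (n + 1))).2 hω.ne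
  filter_upwards [hnat] with ω hω
  exact finite_of_forall_nat (T := fun n => darkStart U (n + 1)) hω

/-- The signal photon does not coincide with a dark count: its time has a hazard rate given the dark
counts, and a single time is negligible. -/
lemma ae_ne_darkStart [IsProbabilityMeasure P] (hU : ∀ j, Measurable (U j))
    (hind : ProbabilityTheory.iIndepFun U P)
    {h : ℝ≥0 → ℝ≥0} (hh : Measurable h) (hhaz : HasHazardRate (P.map (U none)) h) (n : ℕ) :
    ∀ᵐ ω ∂P, U none ω ≠ darkStart U n ω := by
  have hs : MeasurableSet[MeasurableSpace.prod inferInstance (otherCoords U none)]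
      {p : ℝ≥0 × Ω | p.1 = darkStart U n p.2} := by
    let := otherCoords U none
    exact measurableSet_eq_fun measurable_fst
      ((measurable_darkStart_otherCoords (j := none) (by simp)).comp measurable_snd)
  have hc : Measurable[MeasurableSpace.prod inferInstance (otherCoords U none)]
      ({p : ℝ≥0 × Ω | p.1 = darkStart U n p.2}.indicator (1 : ℝ≥0 × Ω → ℝ≥0∞)) := by
    let := otherCoords U none
    exact measurable_one.indicator hs
  have h1 := lintegral_coord_hazard hU hind none hh hhaz (R := fun _ => 0)
    (@measurable_const _ _ _ (otherCoords U none) 0) hc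
  have h2 : ∀ ω, ∫⁻ t, {p : ℝ≥0 × Ω | p.1 = darkStart U n p.2}.indicator (1 : ℝ≥0 × Ω → ℝ≥0∞) (t, ω)
      * (Set.Ioc 0 (0 + U none ω)).indicator (fun t => (h (t - 0) : ℝ≥0∞)) t ∂timeMeasure = 0 := by
    intro ω
    refine (lintegral_congr_ae ?_).trans lintegral_zero
    have hne : ∀ᵐ t ∂timeMeasure, t ≠ darkStart U n ω := by rw [ae_iff]; simp
    filter_upwards [hne] with t ht
    simp [Set.indicator, ht]
  rw [lintegral_congr h2, lintegral_zero] at h1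
  simp only [zero_add] at h1
  have hs' : MeasurableSet {ω | U none ω = darkStart U n ω} :=
    measurableSet_eq_fun (hU none) (measurable_darkStart hU n)
  rw [ae_iff]
  simp only [ne_eq, not_not]
  rw [← lintegral_indicator_one hs', ← h1]
  rfl

lemma ae_mem_goodSet [IsProbabilityMeasure P] (hU : ∀ j, Measurable (U j))
    (hind : ProbabilityTheory.iIndepFun U P)
    {h : ℝ≥0 → ℝ≥0} (hh : Measurable h) (hhaz : HasHazardRate (P.map (U none)) h)
    {r : ℝ≥0} (hr : ∀ n, HasHazardRate (P.map (U (some n))) fun _ => r) :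
    ∀ᵐ ω ∂P, ω ∈ goodSet (countTime U dark) := by
  have h1 : ∀ᵐ ω ∂P, ∀ n, U none ω ≠ darkStart U n ω :=
    ae_all_iff.2 fun n => ae_ne_darkStart hU hind hh hhaz n
  have h2 : ∀ᵐ ω ∂P, ∀ n, 0 < U (some n) ω :=
    ae_all_iff.2 fun n => ae_coord_pos hU (hr n)
  filter_upwards [h1, h2, ae_coord_pos hU hhaz, ae_finite_darkStart_le hU hind hr]
    with ω hω1 hω2 hω3 hω4
  have hmono : StrictMono fun n => darkStart U n ω := strictMono_nat_of_lt_succ fun n => by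
    rw [darkStart_succ]; exact lt_add_of_pos_right _ (hω2 n)
  refine ⟨?_, ?_, ?_⟩
  · rintro (_ | n)
    · rwa [countTime_inl]
    · rw [countTime_inr, darkStart_succ]
      exact (hω2 _).trans_le le_add_self
  · rintro (_ | n) (_ | m) hnm
    · rfl
    · simp only [countTime_inl, countTime_inr] at hnm
      exact absurd hnm (hω1 _)
    · simp only [countTime_inl, countTime_inr] at hnm
      exact absurd hnm.symm (hω1 _)
    · simp only [countTime_inr] at hnm
      have := hmono.injective hnm
      rw [Subtype.ext (show n.1 = m.1 by omega)]
  · intro t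
    have hsub : {i | countTime U dark i ω ≤ t} ⊆ {Sum.inl ()} ∪
        Sum.inr '' ((fun n : {_n : ℕ // dark ≠ 0} => n.1) ⁻¹' {n | darkStart U (n + 1) ω ≤ t}) := by
      rintro (_ | n) hn
      · exact Or.inl rfl
      · refine Or.inr ⟨n, ?_, rfl⟩
        have : countTime U dark (Sum.inr n) ω ≤ t := hn
        rwa [countTime_inr] at this
    refine Set.Finite.subset ((Set.finite_singleton _).union (Set.Finite.image _ ?_)) hsub
    exact (hω4 t).preimage Subtype.val_injective.injOn

end SignalAndDark

section PulseIntensity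

variable {Ω : Type*} {mΩ : MeasurableSpace Ω} {U : Option ℕ → Ω → ℝ≥0} {dark a δ r : ℝ≥0}
  {P : Measure Ω}

variable (U dark mΩ) in
/-- The history of the superposition of the signal photon and the dark current. -/
def countFiltration : Filtration ℝ≥0 mΩ :=
  jumpFiltration mΩ (countTime U dark) fun i => otherCoords U (countCoord dark i)

/-- The pulse is left-continuous in its dependence on the signal photon, so it is predictable. -/
lemma measurable_pulse_predictable (hU : ∀ j, Measurable (U j)) :
    Measurable[(countFiltration mΩ U dark).predictable] fun p : ℝ≥0 × Ω => pulse U a δ p.1 p.2 := by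
  let := (countFiltration mΩ U dark).predictable
  have hfst : Measurable[(countFiltration mΩ U dark).predictable] (Prod.fst : ℝ≥0 × Ω → ℝ≥0) := by
    refine measurable_of_Ioi fun x => ?_
    have : (Prod.fst : ℝ≥0 × Ω → ℝ≥0) ⁻¹' Set.Ioi x = Set.Ioi x ×ˢ Set.univ := by ext; simp
    rw [this]
    exact measurableSet_predictable_Ioi_prod MeasurableSet.univ
  have hset : MeasurableSet[(countFiltration mΩ U dark).predictable]
      {p : ℝ≥0 × Ω | U none p.2 < p.1} := by
    have : {p : ℝ≥0 × Ω | U none p.2 < p.1}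
        = ⋃ q : ℚ, Set.Ioi (Real.toNNReal q) ×ˢ {ω | U none ω ≤ Real.toNNReal q} := by
      ext ⟨t, ω⟩
      simp only [Set.mem_ofPred_eq, Set.mem_iUnion, Set.mem_prod, Set.mem_Ioi]
      constructor
      · intro h
        obtain ⟨q, hq1, hq2⟩ := exists_rat_btwn (show (U none ω : ℝ) < t from h)
        have hq0 : (0 : ℝ) ≤ q := (NNReal.coe_nonneg _).trans hq1.le
        exact ⟨q, (Real.toNNReal_lt_iff_lt_coe hq0).2 hq2, NNReal.le_toNNReal_of_coe_le hq1.le⟩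
      · rintro ⟨q, h1, h2⟩
        exact h2.trans_lt h1
    rw [this]
    refine MeasurableSet.iUnion fun q => measurableSet_predictable_Ioi_prod ?_
    have := measurableSet_le_jumpFiltration (mΩ := mΩ) (measurable_countTime (dark := dark) hU)
      (fun _ _ hik s => exists_otherCoords_countTime_le hik s) (Sum.inl ()) (Real.toNNReal q)
    simp only [countTime_inl] at this
    exact this
  have h1 : MeasurableSet[(countFiltration mΩ U dark).predictable]
      {p : ℝ≥0 × Ω | p.1 ∈ Set.Ioc 0 (U none p.2)} := by
    have : {p : ℝ≥0 × Ω | p.1 ∈ Set.Ioc 0 (U none p.2)}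
        = Prod.fst ⁻¹' Set.Ioi 0 ∩ {p : ℝ≥0 × Ω | U none p.2 < p.1}ᶜ := by
      ext p; simp
    rw [this]
    exact (hfst measurableSet_Ioi).inter hset.compl
  exact ((measurable_unifHazard a δ).comp hfst).indicator h1

lemma lintegral_pulse [IsProbabilityMeasure P] (hU : ∀ j, Measurable (U j))
    (hind : ProbabilityTheory.iIndepFun U P) (hS : P.map (U none) = unifLaw a δ) {A : Set ℝ≥0}
    (hA : MeasurableSet A) :
    ∫⁻ ω, ∫⁻ t in A, (pulse U a δ t ω : ℝ≥0∞) ∂timeMeasure ∂P = unifLaw a δ A := by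
  have hc : Measurable[MeasurableSpace.prod inferInstance (otherCoords U none)]
      fun p : ℝ≥0 × Ω => A.indicator (1 : ℝ≥0 → ℝ≥0∞) p.1 := by
    let := otherCoords U none
    exact (measurable_one.indicator hA).comp measurable_fst
  have h1 := lintegral_coord_hazard hU hind none (measurable_unifHazard a δ)
    (by rw [hS]; exact hasHazardRate_unifLaw a δ) (R := fun _ => 0)
    (@measurable_const _ _ _ (otherCoords U none) 0) hc
  simp only [zero_add, tsub_zero] at h1
  have h2 : ∫⁻ ω, A.indicator (1 : ℝ≥0 → ℝ≥0∞) (U none ω) ∂P = unifLaw a δ A := by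
    rw [← hS, ← lintegral_indicator_one hA, lintegral_map (measurable_one.indicator hA) (hU none)]
  rw [← h2, h1]
  refine lintegral_congr fun ω => ?_
  rw [← lintegral_indicator hA]
  refine lintegral_congr fun t => ?_
  by_cases ht : t ∈ A <;> by_cases ht' : t ∈ Set.Ioc 0 (U none ω) <;> simp [pulse, ht, ht']

/-- The signal photon, uniform on the pulse `[a, a + δ)`, and an independent Poisson dark current
together form a point process with intensity `pulse + dark`. -/
theorem admitsIntensity_pulse [IsProbabilityMeasure P] (hU : ∀ j, Measurable (U j))
    (hind : ProbabilityTheory.iIndepFun U P) (hδ : 0 < δ) (hS : P.map (U none) = unifLaw a δ)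
    (hr : 0 < r) (hD : ∀ n, P.map (U (some n)) = expLaw r) (hrd : dark ≠ 0 → r = dark) :
    AdmitsIntensity P (countFiltration mΩ U dark) (jumpCount (countTime U dark))
      (fun t ω => pulse U a δ t ω + dark) := by
  have hhS : HasHazardRate (P.map (U none)) (unifHazard a δ) := by
    rw [hS]; exact hasHazardRate_unifLaw a δ
  have hhD : ∀ n, HasHazardRate (P.map (U (some n))) fun _ => r := fun n => by
    rw [hD]; exact hasHazardRate_expLaw hr
  have hpm : Measurable fun p : ℝ≥0 × Ω => pulse U a δ p.1 p.2 :=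
    (measurable_pulse_predictable (dark := 0) hU).mono (predictable_le_prod _) le_rfl
  set haz : CountIndex dark → ℝ≥0 → ℝ≥0 := Sum.elim (fun _ => unifHazard a δ) fun _ _ => r with hhaz
  have hhazm : ∀ i, Measurable (haz i) := by
    rintro (_ | _)
    · exact measurable_unifHazard a δ
    · exact measurable_const
  have hhazr : ∀ i, HasHazardRate (P.map (U (countCoord dark i))) (haz i) := by
    rintro (_ | n)
    · exact hhS
    · exact hhD n.1
  set ρ : CountIndex dark → ℝ≥0 → Ω → ℝ≥0∞ := fun i t ω =>
    (Set.Ioc (countStart U dark i ω) (countTime U dark i ω)).indicator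
      (fun t => (haz i (t - countStart U dark i ω) : ℝ≥0∞)) t with hρ
  refine admitsIntensity_jumpCount (ρ := ρ) (fun i => otherCoords_le hU _)
    (measurable_countTime hU) (ae_mem_goodSet hU hind (measurable_unifHazard a δ) hhS hhD)
    (fun _ _ hik s => exists_otherCoords_countTime_le hik s) ?_ ?_ ?_ ?_ ?_ ?_
  · intro i
    have h1 := (measurable_countStart (dark := dark) hU i)
    have hs : MeasurableSet {p : ℝ≥0 × Ω | p.1 ∈ Set.Ioc (countStart U dark i p.2)
        (countTime U dark i p.2)} :=
      (measurableSet_lt (f := fun p : ℝ≥0 × Ω => countStart U dark i p.2)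
        (h1.comp measurable_snd) measurable_fst).inter
      (measurableSet_le (g := fun p : ℝ≥0 × Ω => countTime U dark i p.2) measurable_fst
        ((measurable_countTime hU i).comp measurable_snd))
    have h2 : Measurable fun p : ℝ≥0 × Ω => (haz i (p.1 - countStart U dark i p.2) : ℝ≥0∞) :=
      ((hhazm i).comp (measurable_fst.sub (h1.comp measurable_snd))).coe_nnreal_ennreal
    exact h2.indicator hs
  · intro i t ω ht
    exact Set.indicator_of_notMem (fun h => absurd h.2 (not_le.2 ht)) _
  · intro i c hc
    exact lintegral_coord_hazard hU hind _ (hhazm i) (hhazr i) (measurable_countStart_otherCoords i) hc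
  · filter_upwards [ae_finite_darkStart_le hU hind hhD] with ω hω
    have hne : ∀ᵐ t ∂timeMeasure, t ≠ 0 := by rw [ae_iff]; simp
    filter_upwards [hne] with t ht
    rw [Summable.tsum_sum ENNReal.summable ENNReal.summable, tsum_fintype]
    have h1 : ρ (Sum.inl ()) t ω = (pulse U a δ t ω : ℝ≥0∞) := by
      simp only [hρ, hhaz, countTime_inl, countStart, Sum.elim_inl, tsub_zero, pulse]
      by_cases h : t ∈ Set.Ioc 0 (U none ω) <;> simp [h]
    have h2 : ∑' n : {_n : ℕ // dark ≠ 0}, ρ (Sum.inr n) t ω = dark := by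
      by_cases hd : dark = 0
      · have : IsEmpty {_n : ℕ // dark ≠ 0} := ⟨fun n => n.2 hd⟩
        rw [tsum_empty, hd, ENNReal.coe_zero]
      · have h3 := tsum_indicator_Ioc_darkStart (U := U) (r : ℝ≥0∞) (pos_iff_ne_zero.2 ht) (hω t)
        rw [← (Equiv.subtypeUnivEquiv (p := fun _ : ℕ => dark ≠ 0) fun _ => hd).tsum_eq] at h3
        refine Eq.trans ?_ (h3.trans (by rw [hrd hd]))
        refine tsum_congr fun n => ?_
        simp only [hρ, countTime_inr]
        rfl
    simp [h1, h2]
  · have hpred : Measurable[(countFiltration mΩ U dark).predictable]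
        fun p : ℝ≥0 × Ω => pulse U a δ p.1 p.2 + dark := by
      let := (countFiltration mΩ U dark).predictable
      exact (measurable_pulse_predictable hU).add measurable_const
    have : IsStronglyPredictable (countFiltration mΩ U dark) fun t ω => pulse U a δ t ω + dark :=
      hpred.stronglyMeasurable
    exact this.isStronglyProgressive.isProgressive
  · intro t
    have h1 : ∫⁻ ω, ∫⁻ s in Set.Iic t, (pulse U a δ s ω : ℝ≥0∞) ∂timeMeasure ∂P ≠ ∞ := by
      rw [lintegral_pulse hU hind hS measurableSet_Iic]
      have := isProbabilityMeasure_unifLaw (a := a) hδ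
      exact measure_ne_top _ _
    have h2 : Measurable fun ω => ∫⁻ s in Set.Iic t, (pulse U a δ s ω : ℝ≥0∞) ∂timeMeasure :=
      Measurable.lintegral_prod_right' (f := fun p : Ω × ℝ≥0 => (pulse U a δ p.2 p.1 : ℝ≥0∞))
        (hpm.comp measurable_swap).coe_nnreal_ennreal
    have hfin : timeMeasure (Set.Iic t) ≠ ∞ := by
      rw [timeMeasure_Iic]; exact ENNReal.coe_ne_top
    filter_upwards [ae_lt_top h2 h1] with ω hω
    simp only [ENNReal.coe_add]
    rw [lintegral_add_right _ measurable_const, setLIntegral_const]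
    exact ENNReal.add_lt_top.2 ⟨hω, ENNReal.mul_lt_top ENNReal.coe_lt_top hfin.lt_top⟩

end PulseIntensity

/-! ### Pulse-position signalling -/

section Decoder

variable {M : ℕ}

/-- The time `t`, cut off at `T`. -/
def cutoff (T t : ℝ≥0) : Set.Iic T := ⟨min t T, Set.mem_Iic.2 (min_le_right _ _)⟩

open scoped Classical in
/-- The decoder: the output is sampled at the times `(m + 1) δ` and `(m + 2) δ`, cut off at `T`,
and the guess is a slot `m` in which something was counted, or the last message if there is none. -/
noncomputable def slotDecode (hM : 0 < M) (δ T : ℝ≥0) (y : Set.Iic T → ℕ) : Fin M :=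
  if h : ∃ m : Fin M, y (cutoff T ((m + 1 : ℕ) * δ))
      ≠ y (cutoff T ((m + 2 : ℕ) * δ))
  then h.choose else ⟨M - 1, Nat.sub_lt hM one_pos⟩

lemma measurable_slotDecode (hM : 0 < M) (δ T : ℝ≥0) : Measurable (slotDecode hM δ T) := by
  classical
  set sample : (Set.Iic T → ℕ) → Fin M → ℕ × ℕ := fun y m =>
    (y (cutoff T ((m + 1 : ℕ) * δ)), y (cutoff T ((m + 2 : ℕ) * δ)))
  set g : (Fin M → ℕ × ℕ) → Fin M := fun v =>
    if h : ∃ m : Fin M, (v m).1 ≠ (v m).2 then h.choose else ⟨M - 1, Nat.sub_lt hM one_pos⟩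
  have h1 : Measurable sample := by
    refine measurable_pi_lambda _ fun m => ?_
    exact (measurable_pi_apply _).prodMk (measurable_pi_apply _)
  have h2 : Measurable g := measurable_of_countable g
  exact h2.comp h1

/-- A single count, in the slot of the message `m` and strictly after its beginning, is decoded
correctly; the slot of the last message begins at `T`. -/
lemma slotDecode_eq (hM : 0 < M) {δ : ℝ≥0} {y : ℝ≥0 → ℕ} {s : ℝ≥0} (m : Fin M)
    (hs : (m + 1 : ℕ) * δ < s) (hs' : s < (m + 2 : ℕ) * δ)
    (hy : ∀ t ≤ M * δ, y t = if s ≤ t then 1 else 0) :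
    slotDecode hM δ (M * δ) (fun t => y t) = m := by
  have hmin : ∀ k : ℕ, k ≤ M → min ((k : ℝ≥0) * δ) (M * δ) = k * δ := fun k hk =>
    min_eq_left (by gcongr)
  have hmin' : ∀ k : ℕ, M ≤ k → min ((k : ℝ≥0) * δ) (M * δ) = M * δ := fun k hk =>
    min_eq_right (by gcongr)
  have hval : ∀ k : ℕ, y (min ((k : ℝ≥0) * δ) (M * δ)) = if m + 2 ≤ k ∧ m + 2 ≤ M then 1 else 0 := by
    have hv : ∀ k : ℕ, k ≤ M → y (k * δ) = if m + 2 ≤ k then 1 else 0 := by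
      intro k hk
      rw [hy _ (by gcongr)]
      congr 1
      rw [eq_iff_iff]
      constructor
      · intro h
        by_contra! hc
        have : ((k : ℕ) : ℝ≥0) * δ ≤ (m + 1 : ℕ) * δ := by
          gcongr
          omega
        exact absurd (h.trans this) (not_le.2 hs)
      · intro h
        refine hs'.le.trans ?_
        gcongr
    intro k
    rcases le_total k M with hk | hk
    · rw [hmin k hk, hv k hk]
      congr 1
      rw [eq_iff_iff]
      omega
    · rw [hmin' k hk, hv M le_rfl]
      congr 1
      rw [eq_iff_iff]
      omega
  unfold slotDecode
  simp only [cutoff, hval]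
  have hm := m.2
  by_cases hlast : (m : ℕ) + 2 ≤ M
  · have hex : ∃ j : Fin M, (if (m : ℕ) + 2 ≤ j + 1 ∧ (m : ℕ) + 2 ≤ M then 1 else 0)
        ≠ (if (m : ℕ) + 2 ≤ j + 2 ∧ (m : ℕ) + 2 ≤ M then 1 else 0) := ⟨m, by simp [hlast]⟩
    rw [dif_pos hex]
    have hspec := hex.choose_spec
    set j := hex.choose
    refine Fin.ext ?_
    by_contra hne
    refine hspec ?_
    congr 1
    rw [eq_iff_iff]
    omega
  · rw [dif_neg]
    · exact Fin.ext (by simp only; omega)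
    · simp [hlast]

end Decoder

section Scheme

variable (r : ℝ≥0)

/-- The sample space: one coordinate for the time of the signal photon and one for each gap between
dark counts. -/
abbrev SchemeSpace : Type u := ULift.{u} (Option ℕ) → ℝ≥0

/-- The coordinates of the sample space. -/
def schemeCoord (j : Option ℕ) (ω : SchemeSpace.{u}) : ℝ≥0 := ω ⟨j⟩

/-- The law of a coordinate when the pulse is on `[a, a + δ)`. -/
noncomputable def coordLaw (a δ : ℝ≥0) (j : ULift.{u} (Option ℕ)) : Measure ℝ≥0 :=
  j.down.elim (unifLaw a δ) fun _ => expLaw r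

/-- The law on the sample space that makes the coordinates independent. -/
noncomputable def schemeLaw (a δ : ℝ≥0) : Measure SchemeSpace.{u} :=
  Measure.infinitePi (coordLaw r a δ)

variable {r} {a δ : ℝ≥0}

lemma isProbabilityMeasure_coordLaw (hr : 0 < r) (hδ : 0 < δ) (j : ULift.{u} (Option ℕ)) :
    IsProbabilityMeasure (coordLaw r a δ j) := by
  obtain ⟨_ | n⟩ := j
  · exact isProbabilityMeasure_unifLaw hδ
  · exact isProbabilityMeasure_expLaw hr

lemma measurable_schemeCoord (j : Option ℕ) : Measurable (schemeCoord.{u} j) :=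
  measurable_pi_apply _

lemma isProbabilityMeasure_schemeLaw (hr : 0 < r) (hδ : 0 < δ) :
    IsProbabilityMeasure (schemeLaw.{u} r a δ) := by
  have := isProbabilityMeasure_coordLaw.{u} (r := r) (a := a) hr hδ
  rw [schemeLaw]
  infer_instance

lemma map_schemeCoord (hr : 0 < r) (hδ : 0 < δ) (j : Option ℕ) :
    (schemeLaw.{u} r a δ).map (schemeCoord j) = coordLaw.{u} r a δ ⟨j⟩ := by
  have := isProbabilityMeasure_coordLaw.{u} (r := r) (a := a) hr hδ
  exact Measure.infinitePi_map_eval _ _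

lemma iIndepFun_schemeCoord (hr : 0 < r) (hδ : 0 < δ) :
    ProbabilityTheory.iIndepFun schemeCoord.{u} (schemeLaw.{u} r a δ) := by
  have := isProbabilityMeasure_coordLaw.{u} (r := r) (a := a) hr hδ
  have h := ProbabilityTheory.iIndepFun_infinitePi (P := coordLaw.{u} r a δ)
    (X := fun _ x => x) fun _ => measurable_id
  exact h.precomp (g := fun j : Option ℕ => (⟨j⟩ : ULift.{u} (Option ℕ)))
    fun i j hij => congrArg ULift.down hij

variable {M : ℕ}

/-- Pulse-position signalling with feedback: message `m` is sent as one photon, uniform on the slot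
`[(m + 1) δ, (m + 2) δ)`, and the transmission ends at `M δ`, where the slot of the last message
begins. The rate `r` of the dark gaps is that of the dark current, and arbitrary if there is none. -/
noncomputable def slotScheme (M : ℕ) (hM : 0 < M) (dark r δ : ℝ≥0) (hδ : 0 < δ) (hr : 0 < r)
    (hrd : dark ≠ 0 → r = dark) : FeedbackScheme.{u} M dark where
  T := M * δ
  T_pos := by positivity
  Ω := SchemeSpace.{u}
  mΩ := inferInstance
  P m := schemeLaw r ((m + 1 : ℕ) * δ) δ
  prob _ := isProbabilityMeasure_schemeLaw hr hδ
  F _ := countFiltration inferInstance schemeCoord dark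
  Y := jumpCount (countTime schemeCoord dark)
  X m := pulse schemeCoord ((m + 1 : ℕ) * δ) δ
  input_progressive m := by
    have : IsStronglyPredictable (countFiltration inferInstance schemeCoord.{u} dark)
        (pulse schemeCoord ((m + 1 : ℕ) * δ) δ) :=
      (measurable_pulse_predictable measurable_schemeCoord).stronglyMeasurable
    exact this.isStronglyProgressive.isProgressive
  channel m := by
    have := isProbabilityMeasure_schemeLaw.{u} (a := (m + 1 : ℕ) * δ) hr hδ
    exact admitsIntensity_pulse measurable_schemeCoord (iIndepFun_schemeCoord hr hδ) hδ
      (map_schemeCoord hr hδ none) hr (fun n => map_schemeCoord hr hδ (some n)) hrd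
  decode := slotDecode hM δ (M * δ)
  decode_measurable := measurable_slotDecode hM δ _

variable {dark : ℝ≥0}

/-- A message costs one photon if its slot lies in the transmission interval, and nothing if it is
the last one. -/
lemma messageEnergy_slotScheme (hM : 0 < M) (hδ : 0 < δ) (hr : 0 < r) (hrd : dark ≠ 0 → r = dark)
    (m : Fin M) :
    (slotScheme.{u} M hM dark r δ hδ hr hrd).messageEnergy m = if (m : ℕ) + 1 < M then 1 else 0 := by
  have := isProbabilityMeasure_schemeLaw.{u} (a := (m + 1 : ℕ) * δ) hr hδ
  have h1 : (slotScheme.{u} M hM dark r δ hδ hr hrd).messageEnergy m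
      = unifLaw ((m + 1 : ℕ) * δ) δ (Set.Iic (M * δ)) :=
    lintegral_pulse measurable_schemeCoord (iIndepFun_schemeCoord hr hδ)
      (map_schemeCoord hr hδ none) measurableSet_Iic
  rw [h1]
  have hadd : ((m + 1 : ℕ) : ℝ≥0) * δ + δ = (m + 2 : ℕ) * δ := by push_cast; ring
  split_ifs with hm
  · refine unifLaw_of_Ico_subset hδ measurableSet_Iic fun t ht => ?_
    refine ht.2.le.trans ?_
    rw [hadd]
    gcongr
    omega
  · have hmM : (m : ℕ) + 1 = M := by have := m.2; omega
    rw [unifLaw_apply _ _ measurableSet_Iic, hmM]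
    have : Set.Ico ((M : ℝ≥0) * δ) (M * δ + δ) ∩ Set.Iic (M * δ) ⊆ {(M : ℝ≥0) * δ} :=
      fun t ht => le_antisymm ht.2 ht.1.1
    rw [measure_mono_null this (timeMeasure_singleton _), mul_zero]

lemma energy_slotScheme (hM : 0 < M) (hδ : 0 < δ) (hr : 0 < r) (hrd : dark ≠ 0 → r = dark) :
    (slotScheme.{u} M hM dark r δ hδ hr hrd).energy = ((M : ℝ≥0∞) - 1) / M := by
  rw [FeedbackScheme.energy]
  simp only [messageEnergy_slotScheme]
  congr 1
  obtain ⟨k, rfl⟩ : ∃ k, M = k + 1 := ⟨M - 1, by omega⟩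
  rw [Fin.sum_univ_castSucc]
  simp

lemma expLaw_Iic_le (x : ℝ≥0) : expLaw r (Set.Iic x) ≤ (r * x : ℝ≥0) := by
  rw [expLaw, withDensity_apply _ measurableSet_Iic]
  calc _ ≤ ∫⁻ _ in Set.Iic x, (r : ℝ≥0∞) ∂timeMeasure := by
        refine lintegral_mono fun t => ?_
        rw [← ENNReal.ofReal_coe_nnreal (p := r)]
        refine ENNReal.ofReal_le_ofReal (mul_le_of_le_one_right r.coe_nonneg ?_)
        exact Real.exp_le_one_iff.2 (by simp only [Left.neg_nonpos_iff]; positivity)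
    _ = _ := by
        rw [setLIntegral_const, timeMeasure_Iic, ENNReal.coe_mul]

/-- A decoding error needs a dark count before the end of the transmission. -/
lemma messageError_slotScheme_le (hM : 0 < M) (hδ : 0 < δ) (hr : 0 < r)
    (hrd : dark ≠ 0 → r = dark) (m : Fin M) :
    (slotScheme.{u} M hM dark r δ hδ hr hrd).messageError m ≤ (r * (M * δ) : ℝ≥0) := by
  set a : ℝ≥0 := (m + 1 : ℕ) * δ with ha
  set P := schemeLaw.{u} r a δ with hP
  have := isProbabilityMeasure_schemeLaw.{u} (a := a) hr hδ
  have hS : P.map (schemeCoord none) = unifLaw a δ := map_schemeCoord hr hδ none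
  have hD : ∀ n, P.map (schemeCoord (some n)) = expLaw r := fun n => map_schemeCoord hr hδ (some n)
  have hadd : a + δ = (m + 2 : ℕ) * δ := by rw [ha]; push_cast; ring
  have hslot : ∀ᵐ ω ∂P, schemeCoord none ω ∈ Set.Ioo a (a + δ) := by
    have h1 : unifLaw a δ (Set.Ioo a (a + δ))ᶜ = 0 := by
      rw [unifLaw_apply _ _ measurableSet_Ioo.compl]
      have : Set.Ico a (a + δ) ∩ (Set.Ioo a (a + δ))ᶜ ⊆ {a} := by
        rintro t ⟨h1, h2⟩
        by_contra h3
        exact h2 ⟨lt_of_le_of_ne h1.1 (Ne.symm h3), h1.2⟩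
      rw [measure_mono_null this (timeMeasure_singleton _), mul_zero]
    rw [← hS, Measure.map_apply (measurable_schemeCoord none) measurableSet_Ioo.compl] at h1
    exact h1
  have hgood : ∀ᵐ ω ∂P, ω ∈ goodSet (countTime schemeCoord dark) :=
    ae_mem_goodSet measurable_schemeCoord (iIndepFun_schemeCoord hr hδ) (measurable_unifHazard a δ)
      (by rw [hS]; exact hasHazardRate_unifLaw a δ)
      (fun n => by rw [hD]; exact hasHazardRate_expLaw hr)
  have hdark : P {ω | schemeCoord (some 0) ω ≤ M * δ} ≤ (r * (M * δ) : ℝ≥0) := by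
    have := expLaw_Iic_le (r := r) (M * δ)
    rwa [← hD 0, Measure.map_apply (measurable_schemeCoord _) measurableSet_Iic] at this
  refine le_trans ?_ hdark
  change P {ω | slotDecode hM δ (M * δ) (fun t => jumpCount (countTime schemeCoord dark) t ω) ≠ m} ≤ _
  refine measure_mono_ae ?_
  filter_upwards [hslot, hgood] with ω hω1 hω2 herr
  by_contra hlate
  refine herr (slotDecode_eq hM (s := schemeCoord none ω)
    (y := fun t => jumpCount (countTime schemeCoord dark) t ω) m hω1.1 (hadd ▸ hω1.2) fun t ht => ?_)
  simp only [jumpCount_of_mem hω2]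
  have hset : {i | countTime schemeCoord dark i ω ≤ t}
      = if schemeCoord none ω ≤ t then {Sum.inl ()} else ∅ := by
    ext i
    rcases i with ⟨⟩ | n
    · simp only [Set.mem_ofPred_eq, countTime_inl]
      split_ifs with h <;> simp [h]
    · have h1 : t < countTime schemeCoord dark (Sum.inr n) ω := by
        rw [countTime_inr]
        have h2 := monotone_darkStart (U := schemeCoord) ω (show 1 ≤ n.1 + 1 by omega)
        have h3 : darkStart schemeCoord 1 ω = schemeCoord (some 0) ω := by simp [darkStart]
        refine lt_of_lt_of_le ?_ h2
        simp only [h3]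
        exact ht.trans_lt (not_le.1 hlate)
      simp only [Set.mem_ofPred_eq, not_le.2 h1, false_iff]
      split_ifs <;> simp
  rw [hset]
  split_ifs <;> simp

lemma errorProb_slotScheme_le (hM : 0 < M) (hδ : 0 < δ) (hr : 0 < r)
    (hrd : dark ≠ 0 → r = dark) :
    (slotScheme.{u} M hM dark r δ hδ hr hrd).errorProb ≤ (r * (M * δ) : ℝ≥0) := by
  rw [FeedbackScheme.errorProb]
  refine ENNReal.div_le_of_le_mul ?_
  refine (Finset.sum_le_sum fun m _ => messageError_slotScheme_le hM hδ hr hrd m).trans ?_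
  simp [mul_comm]

end Scheme

/-- The energy `(M - 1) / M` suffices. -/
theorem reliablyTransmittable {M : ℕ} (hM : 1 ≤ M) (dark : ℝ≥0) :
    ReliablyTransmittable.{u} M dark (((M : ℝ≥0∞) - 1) / M) := by
  intro ε hε
  obtain ⟨ε', hε'0, hε'⟩ := ENNReal.lt_iff_exists_nnreal_btwn.1 hε
  obtain ⟨r, hr, hrd⟩ : ∃ r : ℝ≥0, 0 < r ∧ (dark ≠ 0 → r = dark) := by
    by_cases hd : dark = 0
    · exact ⟨1, one_pos, fun h => absurd hd h⟩
    · exact ⟨dark, pos_iff_ne_zero.2 hd, fun _ => rfl⟩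
  have hM0 : (0 : ℝ≥0) < M := by exact_mod_cast hM
  have hε0 : 0 < ε' := by exact_mod_cast hε'0
  -- the transmission must be so short that a dark count is unlikely
  have hδ : 0 < ε' / (r * M) := by positivity
  refine ⟨slotScheme M hM dark r _ hδ hr hrd, energy_slotScheme hM hδ hr hrd,
    (errorProb_slotScheme_le hM hδ hr hrd).trans_lt ?_⟩
  have : r * (M * (ε' / (r * M))) = ε' := by field_simp
  rwa [this]

theorem mainTheorem2 (M : ℕ) (hM : 1 ≤ M) (dark : ℝ≥0) :
    IsLeast {E : ℝ≥0∞ | ReliablyTransmittable.{u} M dark E} (((M : ℝ≥0∞) - 1) / (M : ℝ≥0∞)) :=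
  ⟨reliablyTransmittable hM dark, fun _ hE => le_of_reliablyTransmittable hM hE⟩
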